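/- Setting. Let $X$ be a complete connected $C^\infty$ Riemannian manifold of dimension $d$ with infinite volume, $m$ its volume measure, and $\Gamma_X$ the space of locally finite subsets $\gamma\subset X$ with the vague topology and its Borel $\sigma$-algebra; write $\langle\varphi,\gamma\rangle=\sum_{x\in\gamma}\varphi(x)$, $\gamma_\Lambda=\gamma\cap\Lambda$, $T_\gamma\Gamma_X=\bigoplus_{x\in\gamma}T_xX$ (Hilbert sum), and $\wedge^n(T_\gamma\Gamma_X)$ for the antisymmetric part of $(T_\gamma\Gamma_X)^{\otimes n}$. Let $\mu$ be a probability measure on $\Gamma_X$ such that: (a) $\int\langle\varphi,\gamma\rangle^k\,\mu(d\gamma)<\infty$ for all $k\in\mathbb N$ and all continuous compactly supported $\varphi\ge0$; (b) there is a measurable $\rho(\gamma,x)\ge 0$ such that, for all measurable $F\ge0$ on $\Gamma_X\times X$, $\int\mu(d\gamma)\sum_{x\in\gamma}F(\gamma,x)=\int\mu(d\gamma)\int m(dx)\,\rho(\gamma,x)F(\gamma\cup\{x\},x)$; (c) $\rho>0$ $\mu\otimes m$-a.e., $\rho(\gamma,\cdot)$ is weakly differentiable for $\mu$-a.e. $\gamma$,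 and with $B_\mu(\gamma,x)=\nabla_x\rho(\gamma\setminus\{x\},x)/\rho(\gamma\setminus\{x\},x)$, for each open relatively compact $\Lambda\subset X$ there is $\varepsilon>0$ with $\int\big(\sum_{x\in\gamma_\Lambda}|B_\mu(\gamma,x)|_x\big)^{2+\varepsilon}\mu(d\gamma)<\infty$. Forms. For a form $W:\gamma\mapsto W(\gamma)\in\wedge^n(T_\gamma\Gamma_X)$, the covariant gradient $\nabla^\Gamma W(\gamma)\in T_\gamma\Gamma_X\otimes\wedge^n(T_\gamma\Gamma_X)$ has as its components ($x\in\gamma$) the Levi-Civita covariant derivatives at $y=x$ of $y\mapsto W((\gamma\setminus\{x\})\cup\{y\})$; higher derivatives $(\nabla^\Gamma)^{(k)}$ are defined by iteration. For $n\ge1$, $\mathcal F\Omega^n$ is the space of infinitely differentiable forms $W$ that are local ($W(\gamma)=W(\gamma_\Lambda)$ for all $\gamma$, for some open relatively compact $\Lambda$) and satisfy $\|W(\gamma)\|^2\le\langle\varphi,\gamma\rangle^l$ for some continuous compactly supported $\varphi\ge0$ and $l\ge1$. $L^2_\mu\Omega^n$ is the Hilbert space completion of $\mathcal F\Omega^n$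 for $(W_1,W_2)=\int\langle W_1(\gamma),W_2(\gamma)\rangle\,\mu(d\gamma)$, and $L^2_\mu\Omega^0=L^2(\Gamma_X;\mu)$. For $n\ge1$, $\mathcal E\Omega^n$ is the set of $W\in\mathcal F\Omega^n$ such that for every $k$ one has $\|(\nabla^\Gamma)^{(k)}W(\gamma)\|^2\le\langle\varphi,\gamma\rangle^l$ for some $\varphi\in C_0^\infty(X)$, $\varphi\ge0$, $l\ge1$, and such that, for all $\gamma\in\Gamma_X$ and $r\in\mathbb N$, $(x_1,\dots,x_r)\mapsto W(\gamma\cup\{x_1,\dots,x_r\})$, defined for distinct $x_i\notin\gamma$, extends to a smooth form $X^r\ni(x_1,\dots,x_r)\mapsto\omega(x_1,\dots,x_r)\in\wedge^n(T_\gamma\Gamma_X\oplus T_{x_1}X\oplus\dots\oplus T_{x_r}X)$. $\mathcal E\Omega^0$ is the set of functions $g(\langle\varphi_1,\gamma\rangle,\dots,\langle\varphi_N,\gamma\rangle)$ with $\varphi_i\in C_0^\infty(X)$ and $g\in C_b^\infty(\mathbb R^N)$ (bounded with all its derivatives). Let $\mathbf d_n:\mathcal E\Omega^n\to\mathcal E\Omega^{n+1}$,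 $\mathbf d_nW=(n+1)^{1/2}\operatorname{AS}_{n+1}(\nabla^\Gamma W)$, with $\operatorname{AS}_{n+1}$ the antisymmetrization projection, regarded as an operator from $L^2_\mu\Omega^n$ to $L^2_\mu\Omega^{n+1}$; let $\mathbf d_n^*$ be its adjoint and $\bar{\mathbf d}_n$ its closure (the operator whose graph is the closure of the graph of $\mathbf d_n$). Let $n\ge1$, $Z^n=\operatorname{Ker}\bar{\mathbf d}_n$, $B^n=\overline{\operatorname{Im}\mathbf d_{n-1}}$, $\mathcal H^n_\mu=Z^n/B^n$ with the quotient norm, and let $\mathbf H^{\mathrm R}_{\mu,n}$ be the generator of the closed form $\mathcal E^{\mathrm R}_{\mu,n}(W,W')=(\bar{\mathbf d}_nW,\bar{\mathbf d}_nW')+(\mathbf d_{n-1}^*W,\mathbf d_{n-1}^*W')$ with domain $D(\bar{\mathbf d}_n)\cap D(\mathbf d_{n-1}^*)$. Proposition. For every $n\ge 1$, $B^n\subset Z^n$, the space $Z^n$ is closed in $L^2_\mu\Omega^n$, and $\operatorname{Ker}\mathbf H^{\mathrm R}_{\mu,n}$ is the orthogonal complement of $B^n$ in $Z^n$. The natural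 isomorphism between $\mathcal H^n_\mu$ and this orthogonal complement (which sends the class of $z\in Z^n$ to the element $h$ of the complement with $z-h\in B^n$) is an isomorphism of Hilbert spaces $\mathcal H^n_\mu\simeq\operatorname{Ker}\mathbf H^{\mathrm R}_{\mu,n}$. Moreover there is the weak Hodge-deRham orthogonal decomposition $L^2_\mu\Omega^n=\operatorname{Ker}\mathbf H^{\mathrm R}_{\mu,n}\oplus\overline{\operatorname{Im}\mathbf d_{n-1}}\oplus\overline{\operatorname{Im}\mathbf d_n^*}$. -/

import Mathlib

open scoped Manifold ContDiff Bundle ENNReal Topology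
open MeasureTheory Set Bundle

noncomputable section

namespace ConfigForms

/-! ### Configurations -/

/-- The space `Γ_X` of locally finite subsets (configurations) of `X`. -/
@[ext]
structure Config (X : Type*) [TopologicalSpace X] where
  carrier : Set X
  finite_inter : ∀ K : Set X, IsCompact K → (carrier ∩ K).Finite

namespace Config

variable {X : Type*} [TopologicalSpace X]

/-- `⟨φ, γ⟩ = ∑_{x ∈ γ} φ x` (a finite sum when `φ` has compact support). -/
def pairing (φ : X → ℝ) (γ : Config X) : ℝ := ∑ᶠ x ∈ γ.carrier, φ x

/-- The vague topology: the coarsest one for which all `γ ↦ ⟨φ, γ⟩`, with `φ` continuous and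
compactly supported, are continuous. -/
instance : TopologicalSpace (Config X) :=
  TopologicalSpace.induced
    (fun γ (φ : {φ : X → ℝ // Continuous φ ∧ HasCompactSupport φ}) => pairing φ.1 γ)
    Pi.topologicalSpace

instance : MeasurableSpace (Config X) := borel _
instance : BorelSpace (Config X) := ⟨rfl⟩

lemma continuous_pairing {φ : X → ℝ} (h1 : Continuous φ) (h2 : HasCompactSupport φ) :
    Continuous (pairing φ) :=
  continuous_pi_iff.1 (continuous_induced_dom (f := fun (γ : Config X)
    (φ : {φ : X → ℝ // Continuous φ ∧ HasCompactSupport φ}) => pairing φ.1 γ)) ⟨φ, h1, h2⟩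

/-- `γ_Λ = γ ∩ Λ`. -/
def restrict (γ : Config X) (Λ : Set X) : Config X where
  carrier := γ.carrier ∩ Λ
  finite_inter K hK := (γ.finite_inter K hK).subset fun _ hx => ⟨hx.1.1, hx.2⟩

/-- `γ - ε_x`. -/
def erase (γ : Config X) (x : X) : Config X where
  carrier := γ.carrier \ {x}
  finite_inter K hK := (γ.finite_inter K hK).subset fun _ hx => ⟨hx.1.1, hx.2⟩

/-- `γ + ε_{x_1} + … + ε_{x_r}` (used when the points are distinct and outside `γ`). -/
def addPts (γ : Config X) {r : ℕ} (x : Fin r → X) : Config X where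
  carrier := γ.carrier ∪ range x
  finite_inter K hK := by
    rw [union_inter_distrib_right]
    exact (γ.finite_inter K hK).union ((finite_range x).subset inter_subset_left)

/-- `γ + ε_y`. -/
def add (γ : Config X) (y : X) : Config X := γ.addPts (fun _ : Fin 1 => y)

/-- `γ - ε_x + ε_y`. -/
def move (γ : Config X) (x y : X) : Config X := (γ.erase x).add y

end Config

/-- The measure `μ` on `Γ_X` has all moments finite. -/
class HasFiniteMoments {X : Type*} [TopologicalSpace X] (μ : Measure (Config X)) : Prop where
  integrable_pow : ∀ (k : ℕ) (φ : X → ℝ), Continuous φ → HasCompactSupport φ → (∀ x, 0 ≤ φ x) →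
    Integrable (fun γ => Config.pairing φ γ ^ k) μ

/-! ### Tensors over configurations

`n`-tensors on `T_γ Γ_X = ⨁_{x ∈ γ} T_x X` are described by their components: the component of
index `(x_1, …, x_n) ∈ γ^n` is an `n`-linear form on `T_{x_1} X × … × T_{x_n} X` (tangent vectors
and covectors being identified through the Riemannian metric).  The components are indexed by all
of `X^n`, and those with an index outside `γ^n` are zero. -/

variable (d : ℕ) (X : Type*)

section Topological

variable [TopologicalSpace X] [ChartedSpace (EuclideanSpace ℝ (Fin d)) X]

/-- Components at a single configuration. -/
abbrev Coeff (n : ℕ) : Type _ :=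
  (x : Fin n → X) → ((i : Fin n) → TangentSpace (𝓡 d) (x i)) → ℝ

/-- Tensor fields of order `n` over `Γ_X` (without any condition yet). -/
abbrev TensorField (n : ℕ) : Type _ := Config X → Coeff d X n

end Topological

variable {d X}

section Riemannian

variable [TopologicalSpace X] [ChartedSpace (EuclideanSpace ℝ (Fin d)) X]
  [IsManifold (𝓡 d) ∞ X]
  [RiemannianBundle (fun x : X => TangentSpace (𝓡 d) x)]

/-- An orthonormal basis of `T_p X`. -/
def onb (p : X) : OrthonormalBasis (Fin d) ℝ (TangentSpace (𝓡 d) p) :=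
  haveI : FiniteDimensional ℝ (TangentSpace (𝓡 d) p) :=
    inferInstanceAs (FiniteDimensional ℝ (EuclideanSpace ℝ (Fin d)))
  (stdOrthonormalBasis ℝ (TangentSpace (𝓡 d) p)).reindex
    (finCongr (finrank_euclideanSpace_fin (𝕜 := ℝ) (n := d)))

/-- Inner product of the components of index `x` in `T_{x_1} X ⊗ … ⊗ T_{x_n} X`. -/
def compInner {n : ℕ} (u v : Coeff d X n) (x : Fin n → X) : ℝ :=
  ∑ J : Fin n → Fin d, u x (fun i => onb (x i) (J i)) * v x (fun i => onb (x i) (J i))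

/-- Inner product of the Hilbert space `(T_γ Γ_X)^{⊗ n}`. -/
def tInner {n : ℕ} (u v : Coeff d X n) : ℝ := ∑' x : Fin n → X, compInner u v x

/-! ### Levi-Civita connection and covariant derivative -/

/-- The tangent vector at `y` whose coordinates in the preferred chart at `p` are `w`. -/
def frame (p y : X) (w : EuclideanSpace ℝ (Fin d)) : TangentSpace (𝓡 d) y :=
  (trivializationAt (EuclideanSpace ℝ (Fin d)) (TangentSpace (𝓡 d) (M := X)) p).symmL ℝ y w

/-- The point with coordinates `z` in the preferred chart at `p`. -/
def chartPt (p : X) (z : EuclideanSpace ℝ (Fin d)) : X :=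
  (chartAt (EuclideanSpace ℝ (Fin d)) p).symm z

/-- The coordinates of `p` in the preferred chart at `p`. -/
def chartCenter (p : X) : EuclideanSpace ℝ (Fin d) := chartAt (EuclideanSpace ℝ (Fin d)) p p

/-- The metric coefficient `g_z(v, w)` in the preferred chart at `p`. -/
def metricCoeff (p : X) (v w z : EuclideanSpace ℝ (Fin d)) : ℝ :=
  inner ℝ (frame p (chartPt p z) v) (frame p (chartPt p z) w)

/-- The Christoffel map `(v, w) ↦ Γ(v, w)` of the Levi-Civita connection at `p`, in the preferred
chart at `p`: `2 g(Γ(v, w), u) = D_v g(w, u) + D_w g(v, u) - D_u g(v, w)`. -/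
def christoffel (p : X) (v w : TangentSpace (𝓡 d) p) : TangentSpace (𝓡 d) p :=
  ∑ j : Fin d,
    ((1 / 2 : ℝ) *
      (fderiv ℝ (metricCoeff p w (onb p j)) (chartCenter p) v
        + fderiv ℝ (metricCoeff p v (onb p j)) (chartCenter p) w
        - fderiv ℝ (metricCoeff p v w) (chartCenter p) (onb p j))) • onb p j

/-- The component of index `x` of the section `y ↦ U(γ - ε_p + ε_y)`, in the preferred chart at
`p`: the slots sitting at `p` are moved to `y` and evaluated on the vectors at `y` with constant
coordinates, the other slots are evaluated on fixed vectors. -/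
def localRep {n : ℕ} (U : TensorField d X n) (γ : Config X) (p : X) (x : Fin n → X)
    (w : Fin n → EuclideanSpace ℝ (Fin d)) (z : EuclideanSpace ℝ (Fin d)) : ℝ :=
  open Classical in
  U (γ.move p (chartPt p z)) (fun i => if x i = p then chartPt p z else x i)
    (fun i => (if x i = p then frame p (chartPt p z) (w i) else w i :
      EuclideanSpace ℝ (Fin d)))

/-- The covariant gradient `∇^Γ U(γ) ∈ T_γ Γ_X ⊗ (T_γ Γ_X)^{⊗ n}`; the slot `0` is the
differentiation slot. -/
def covGrad {n : ℕ} (U : TensorField d X n) : TensorField d X (n + 1) := fun γ x v =>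
  open Classical in
  if x 0 ∈ γ.carrier then
    fderiv ℝ (localRep U γ (x 0) (fun i => x i.succ) (fun i => v i.succ)) (chartCenter (x 0)) (v 0)
      - ∑ i : Fin n, if x i.succ = x 0 then
          U γ (fun i => x i.succ)
            (Function.update (fun i : Fin n => v i.succ) i
              (christoffel (x 0) (v 0) (v i.succ)))
        else 0
  else 0

/-- The iterated covariant gradient `(∇^Γ)^{(k)} U`. -/
def iterGrad {n : ℕ} (U : TensorField d X n) : (k : ℕ) → TensorField d X (n + k)
  | 0 => U
  | k + 1 => covGrad (iterGrad U k)

/-- `U` is differentiable at every configuration: for all `γ` and `p ∈ γ`, the section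
`y ↦ U(γ - ε_p + ε_y)` is differentiable at `p`. -/
def IsDiff {n : ℕ} (U : TensorField d X n) : Prop :=
  ∀ (γ : Config X) (p : X), p ∈ γ.carrier → ∀ (x : Fin n → X)
    (w : Fin n → EuclideanSpace ℝ (Fin d)),
    DifferentiableAt ℝ (localRep U γ p x w) (chartCenter p)

/-- The antisymmetrization projection of `(T_γ Γ_X)^{⊗ n}` onto `∧^n (T_γ Γ_X)`. -/
def antisymmetrize {n : ℕ} (u : Coeff d X n) : Coeff d X n := fun x v =>
  ((n.factorial : ℝ))⁻¹ * ∑ σ : Equiv.Perm (Fin n),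
    ((Equiv.Perm.sign σ : ℤ) : ℝ) * u (fun i => x (σ i)) (fun i => v (σ i))

/-- The Hodge-deRham differential `(d_n W)(γ) = (n+1)^{1/2} AS_{n+1}(∇^Γ W(γ))`. -/
def extD {n : ℕ} (W : TensorField d X n) : TensorField d X (n + 1) := fun γ =>
  Real.sqrt (n + 1) • antisymmetrize (covGrad W γ)

/-! ### Differential forms over `Γ_X` -/

/-- `W(γ) ∈ ∧^n (T_γ Γ_X)` for all `γ`, where `∧^n` of a Hilbert space is the space of
antisymmetric elements of the `n`-th Hilbert tensor power. -/
structure IsForm {n : ℕ} (W : TensorField d X n) : Prop where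
  supp : ∀ γ x v, (∃ i, x i ∉ γ.carrier) → W γ x v = 0
  multilinear : ∀ γ x, ∃ m : MultilinearMap ℝ (fun i => TangentSpace (𝓡 d) (x i)) ℝ,
    ∀ v, W γ x v = m v
  alternating : ∀ γ x v (σ : Equiv.Perm (Fin n)),
    W γ (fun i => x (σ i)) (fun i => v (σ i)) = ((Equiv.Perm.sign σ : ℤ) : ℝ) * W γ x v
  summable : ∀ γ, Summable (compInner (W γ) (W γ))

/-- Local, infinitely differentiable forms whose squared norm is bounded by `⟨φ, γ⟩^l`. -/
structure IsLocalForm {n : ℕ} (W : TensorField d X n) : Prop extends IsForm W where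
  isLocal : ∃ Λ : Set X, IsOpen Λ ∧ IsCompact (closure Λ) ∧ ∀ γ, W γ = W (γ.restrict Λ)
  diff : ∀ k, IsDiff (iterGrad W k)
  bound : ∃ (φ : X → ℝ) (l : ℕ), Continuous φ ∧ HasCompactSupport φ ∧ (∀ x, 0 ≤ φ x) ∧ 1 ≤ l ∧
    ∀ γ, tInner (W γ) (W γ) ≤ Config.pairing φ γ ^ l

variable (d X) in
/-- The set `𝓕Ω^n`, `n ≥ 1`.  The second clause expresses the measurability of `W` as a section of
the field of Hilbert spaces `γ ↦ ∧^n (T_γ Γ_X)`, tested as usual against a total family of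
sections. -/
def FForms (n : ℕ) : Set (TensorField d X n) :=
  {W | IsLocalForm W ∧ ∀ V : TensorField d X n, IsLocalForm V →
    Measurable fun γ => tInner (W γ) (V γ)}

/-- The point of `X` designated by a label: a point of `γ`, or the `j`-th of the points
`x_1, …, x_r`. -/
def labelPt {γ : Config X} {r : ℕ} (x : Fin r → X) : γ.carrier ⊕ Fin r → X :=
  Sum.elim (fun p => (p : X)) x

/-- For each `γ` and `r`, the map `(x_1, …, x_r) ↦ W(γ + ε_{x_1} + … + ε_{x_r})`, defined for
distinct points outside `γ`, extends to a smooth form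
`θ : X^r → ∧^n (T_γ Γ_X ⊕ T_{x_1} X ⊕ … ⊕ T_{x_r} X)`.  The components of `θ` are indexed by
`n`-tuples of labels in `γ ⊔ {1, …, r}`, and smoothness is read in charts. -/
def HasSmoothExtension {n : ℕ} (W : TensorField d X n) : Prop :=
  ∀ (γ : Config X) (r : ℕ),
    ∃ θ : (a : Fin n → γ.carrier ⊕ Fin r) → (x : Fin r → X) →
        MultilinearMap ℝ (fun i => TangentSpace (𝓡 d) (labelPt x (a i))) ℝ,
      (∀ a x v (σ : Equiv.Perm (Fin n)),
        θ (fun i => a (σ i)) x (fun i => v (σ i)) = ((Equiv.Perm.sign σ : ℤ) : ℝ) * θ a x v) ∧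
      (∀ x : Fin r → X, Function.Injective x → (∀ j, x j ∉ γ.carrier) → ∀ a v,
        θ a x v = W (γ.addPts x) (fun i => labelPt x (a i)) v) ∧
      (∀ (a : Fin n → γ.carrier ⊕ Fin r) (p : Fin r → X)
        (w : Fin n → EuclideanSpace ℝ (Fin d)),
        ContDiffAt ℝ ∞
          (fun z : Fin r → EuclideanSpace ℝ (Fin d) =>
            θ a (fun j => chartPt (p j) (z j))
              (fun i => (Sum.elim (fun _ => w i)
                (fun j => frame (p j) (chartPt (p j) (z j)) (w i)) (a i) :
                  EuclideanSpace ℝ (Fin d))))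
          (fun j => chartCenter (p j)))

variable (d X) in
/-- Smooth compactly supported functions on `X`. -/
def TestFun : Set (X → ℝ) :=
  {φ | ContMDiff (𝓡 d) 𝓘(ℝ, ℝ) ∞ φ ∧ HasCompactSupport φ}

variable (d X) in
/-- The set `𝓕C_b^∞(𝓓, Γ_X)` of the functions `γ ↦ g(⟨φ_1, γ⟩, …, ⟨φ_N, γ⟩)`. -/
def CylinderFun : Set (Config X → ℝ) :=
  {F | ∃ (N : ℕ) (g : (Fin N → ℝ) → ℝ) (φ : Fin N → X → ℝ),
    ContDiff ℝ ∞ g ∧ (∀ k : ℕ, ∃ C : ℝ, ∀ y, ‖iteratedFDeriv ℝ k g y‖ ≤ C) ∧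
    (∀ i, φ i ∈ TestFun d X) ∧ ∀ γ, F γ = g (fun i => Config.pairing (φ i) γ)}

variable (d X) in
/-- The set `𝓔Ω^n`; by convention `𝓔Ω^0 = 𝓕C_b^∞(𝓓, Γ_X)`. -/
def EForms : (n : ℕ) → Set (TensorField d X n)
  | 0 => {W | ∃ F ∈ CylinderFun d X, W = fun γ _ _ => F γ}
  | n + 1 => {W | W ∈ FForms d X (n + 1) ∧ HasSmoothExtension W ∧
      ∀ k : ℕ, ∃ (φ : X → ℝ) (l : ℕ), φ ∈ TestFun d X ∧ (∀ x, 0 ≤ φ x) ∧ 1 ≤ l ∧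
        ∀ γ, tInner (iterGrad W k γ) (iterGrad W k γ) ≤ Config.pairing φ γ ^ l}

/-! ### The Hilbert spaces `L²_μ Ω^n` -/

/-- The square-integrable forms whose classes generate `L²_μ Ω^n`: for `n ≥ 1` these are the
elements of `𝓕Ω^n`; for `n = 0` these are all square-integrable functions, so that
`L²_μ Ω^0 = L²(Γ_X; μ)`. -/
def L2Forms (μ : Measure (Config X)) : (n : ℕ) → Set (TensorField d X n)
  | 0 => {W | MemLp (fun γ => W γ Fin.elim0 fun i => i.elim0) 2 μ}
  | n + 1 => FForms d X (n + 1)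

/-- The vector space of the forms in `L2Forms μ n`.  (`L2Forms μ n` is closed under linear
combinations; `span` only records this.) -/
def PreL2 (μ : Measure (Config X)) (n : ℕ) : Type _ :=
  Submodule.span ℝ (L2Forms (d := d) μ n)

instance (μ : Measure (Config X)) (n : ℕ) : AddCommGroup (PreL2 (d := d) μ n) :=
  inferInstanceAs (AddCommGroup (Submodule.span ℝ (L2Forms (d := d) μ n)))

instance (μ : Measure (Config X)) (n : ℕ) : Module ℝ (PreL2 (d := d) μ n) :=
  inferInstanceAs (Module ℝ (Submodule.span ℝ (L2Forms (d := d) μ n)))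

lemma compInner_comm {n : ℕ} (u v : Coeff d X n) (x : Fin n → X) :
    compInner u v x = compInner v u x := by
  simp only [compInner, mul_comm]

lemma compInner_add_left {n : ℕ} (u u' v : Coeff d X n) (x : Fin n → X) :
    compInner (u + u') v x = compInner u v x + compInner u' v x := by
  simp only [compInner, Pi.add_apply, add_mul, Finset.sum_add_distrib]

lemma compInner_smul_left {n : ℕ} (c : ℝ) (u v : Coeff d X n) (x : Fin n → X) :
    compInner (c • u) v x = c * compInner u v x := by
  simp only [compInner, Pi.smul_apply, smul_eq_mul, mul_assoc, Finset.mul_sum]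

lemma compInner_self_nonneg {n : ℕ} (u : Coeff d X n) (x : Fin n → X) :
    0 ≤ compInner u u x :=
  Finset.sum_nonneg fun _ _ => mul_self_nonneg _

lemma abs_compInner_le {n : ℕ} (u v : Coeff d X n) (x : Fin n → X) :
    |compInner u v x| ≤ compInner u u x + compInner v v x := by
  unfold compInner
  refine (Finset.abs_sum_le_sum_abs _ _).trans ?_
  rw [← Finset.sum_add_distrib]
  refine Finset.sum_le_sum fun J _ => ?_
  rw [abs_le]
  constructor <;> nlinarith [sq_nonneg (u x (fun i => onb (x i) (J i)) +
    v x (fun i => onb (x i) (J i))), sq_nonneg (u x (fun i => onb (x i) (J i)) -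
    v x (fun i => onb (x i) (J i))), sq_nonneg (u x (fun i => onb (x i) (J i))),
    sq_nonneg (v x (fun i => onb (x i) (J i)))]

lemma summable_compInner {n : ℕ} {u v : Coeff d X n} (hu : Summable (compInner u u))
    (hv : Summable (compInner v v)) : Summable (compInner u v) :=
  Summable.of_norm_bounded (hu.add hv) fun x => by
    simpa [Real.norm_eq_abs] using abs_compInner_le u v x

lemma abs_tInner_le {n : ℕ} {u v : Coeff d X n} (hu : Summable (compInner u u))
    (hv : Summable (compInner v v)) : |tInner u v| ≤ tInner u u + tInner v v := by
  unfold tInner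
  rw [← hu.tsum_add hv, ← Real.norm_eq_abs]
  exact tsum_of_norm_bounded (hu.add hv).hasSum fun x => by
    simpa [Real.norm_eq_abs] using abs_compInner_le u v x

lemma tInner_comm {n : ℕ} (u v : Coeff d X n) : tInner u v = tInner v u := by
  simp only [tInner, compInner_comm u v]

lemma tInner_self_nonneg {n : ℕ} (u : Coeff d X n) : 0 ≤ tInner u u :=
  tsum_nonneg fun x => compInner_self_nonneg u x

lemma tInner_smul_left {n : ℕ} (c : ℝ) (u v : Coeff d X n) :
    tInner (c • u) v = c * tInner u v := by
  simp only [tInner, compInner_smul_left, tsum_mul_left]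

lemma summable_of_mem {μ : Measure (Config X)} {n : ℕ} {W : TensorField d X n}
    (hW : W ∈ Submodule.span ℝ (L2Forms μ n)) (γ : Config X) :
    Summable (compInner (W γ) (W γ)) := by
  induction hW using Submodule.span_induction with
  | mem W hW =>
    cases n with
    | zero => exact Summable.of_finite
    | succ n => exact hW.1.summable γ
  | zero =>
    have : compInner ((0 : TensorField d X n) γ) ((0 : TensorField d X n) γ) = 0 := by
      funext x; simp [compInner]
    rw [this]; exact summable_zero
  | add U V _ _ hU hV =>
    have h := summable_compInner hU hV
    refine ((hU.add hV).add (h.add h)).congr fun x => ?_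
    have e : (U + V) γ = U γ + V γ := rfl
    rw [e, compInner_add_left, compInner_comm (U γ) (U γ + V γ), compInner_comm (V γ) (U γ + V γ),
      compInner_add_left, compInner_add_left, compInner_comm (V γ) (U γ)]
    ring
  | smul c U _ hU =>
    refine ((hU.mul_left c).mul_left c).congr fun x => ?_
    have e : (c • U) γ = c • U γ := rfl
    rw [e, compInner_smul_left, compInner_comm (U γ) (c • U γ), compInner_smul_left]

lemma tInner_add_left_of_mem {μ : Measure (Config X)} {n : ℕ} {U U' V : TensorField d X n}
    (hU : U ∈ Submodule.span ℝ (L2Forms μ n)) (hU' : U' ∈ Submodule.span ℝ (L2Forms μ n))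
    (hV : V ∈ Submodule.span ℝ (L2Forms μ n)) (γ : Config X) :
    tInner ((U + U') γ) (V γ) = tInner (U γ) (V γ) + tInner (U' γ) (V γ) := by
  have e : (U + U') γ = U γ + U' γ := rfl
  simp only [e, tInner, compInner_add_left]
  exact (summable_compInner (summable_of_mem hU γ) (summable_of_mem hV γ)).tsum_add
    (summable_compInner (summable_of_mem hU' γ) (summable_of_mem hV γ))

lemma integrable_gen {μ : Measure (Config X)} [HasFiniteMoments μ] {n : ℕ}
    {U V : TensorField d X n} (hU : U ∈ L2Forms μ n) (hV : V ∈ L2Forms μ n) :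
    Integrable (fun γ => tInner (U γ) (V γ)) μ := by
  cases n with
  | zero =>
    have h := MemLp.integrable_mul (p := 2) (q := 2) hU hV
    refine h.congr (Filter.Eventually.of_forall fun γ => ?_)
    have hx : ∀ W : TensorField d X 0, ∀ x v,
        W γ x v = W γ Fin.elim0 (fun i => i.elim0) := by
      intro W x v
      obtain rfl : x = Fin.elim0 := Subsingleton.elim _ _
      obtain rfl : v = fun i => i.elim0 := Subsingleton.elim _ _
      rfl
    simp only [Pi.mul_apply, tInner, compInner]
    rw [tsum_eq_single (Fin.elim0) (fun b hb => (hb (Subsingleton.elim _ _)).elim)]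
    simp [hx U, hx V]
  | succ n =>
    obtain ⟨φ, l, h1, h2, h3, -, h5⟩ := hU.1.bound
    obtain ⟨ψ, m, k1, k2, k3, -, k5⟩ := hV.1.bound
    refine Integrable.mono' ((HasFiniteMoments.integrable_pow l φ h1 h2 h3).add
      (HasFiniteMoments.integrable_pow m ψ k1 k2 k3)) (hU.2 V hV.1).aestronglyMeasurable
      (Filter.Eventually.of_forall fun γ => ?_)
    rw [Real.norm_eq_abs]
    exact (abs_tInner_le (hU.1.summable γ) (hV.1.summable γ)).trans (add_le_add (h5 γ) (k5 γ))

lemma integrable_tInner {μ : Measure (Config X)} [HasFiniteMoments μ] {n : ℕ}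
    {U V : TensorField d X n} (hU : U ∈ Submodule.span ℝ (L2Forms μ n))
    (hV : V ∈ Submodule.span ℝ (L2Forms μ n)) :
    Integrable (fun γ => tInner (U γ) (V γ)) μ := by
  have hz : ∀ V : TensorField d X n, ∀ γ, tInner ((0 : TensorField d X n) γ) (V γ) = 0 := by
    intro V γ; simp [tInner, compInner]
  induction hU using Submodule.span_induction with
  | mem U hU =>
    simp only [tInner_comm (U _)]
    induction hV using Submodule.span_induction with
    | mem V hV => exact integrable_gen hV hU
    | zero => simp only [hz]; exact integrable_zero _ _ _
    | add V V' hV hV' h h' =>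
      simp only [tInner_add_left_of_mem hV hV' (Submodule.subset_span hU)]
      exact h.add h'
    | smul c V _ h =>
      have e : ∀ γ, (c • V) γ = c • V γ := fun _ => rfl
      simp only [e, tInner_smul_left]
      exact h.const_mul c
  | zero => simp only [hz]; exact integrable_zero _ _ _
  | add U U' hU hU' h h' =>
    simp only [tInner_add_left_of_mem hU hU' hV]
    exact h.add h'
  | smul c U _ h =>
    have e : ∀ γ, (c • U) γ = c • U γ := fun _ => rfl
    simp only [e, tInner_smul_left]
    exact h.const_mul c

/-- The scalar product `(W_1, W_2) = ∫ ⟨W_1(γ), W_2(γ)⟩ μ(dγ)`. -/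
@[reducible]
def preCore (μ : Measure (Config X)) [HasFiniteMoments μ] (n : ℕ) :
    PreInnerProductSpace.Core ℝ (PreL2 (d := d) μ n) where
  inner U V := ∫ γ, tInner (U.1 γ) (V.1 γ) ∂μ
  conj_inner_symm U V := by
    simp only [conj_trivial]
    exact integral_congr_ae (Filter.Eventually.of_forall fun γ => tInner_comm _ _)
  re_inner_nonneg U := integral_nonneg fun γ => tInner_self_nonneg _
  add_left U V W := by
    rw [← integral_add (integrable_tInner U.2 W.2) (integrable_tInner V.2 W.2)]
    exact integral_congr_ae (Filter.Eventually.of_forall fun γ =>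
      tInner_add_left_of_mem U.2 V.2 W.2 γ)
  smul_left U V c := by
    simp only [conj_trivial]
    rw [← integral_const_mul]
    exact integral_congr_ae (Filter.Eventually.of_forall fun γ => tInner_smul_left c _ _)

instance (μ : Measure (Config X)) [HasFiniteMoments μ] (n : ℕ) :
    SeminormedAddCommGroup (PreL2 (d := d) μ n) :=
  @InnerProductSpace.Core.toSeminormedAddCommGroup ℝ _ _ _ _ (preCore μ n)

instance (μ : Measure (Config X)) [HasFiniteMoments μ] (n : ℕ) :
    InnerProductSpace ℝ (PreL2 (d := d) μ n) :=
  InnerProductSpace.ofCore (preCore μ n)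

variable (d) in
/-- The Hilbert space `L²_μ Ω^n`. -/
abbrev L2Space (μ : Measure (Config X)) [HasFiniteMoments μ] (n : ℕ) : Type _ :=
  UniformSpace.Completion (PreL2 (d := d) μ n)

lemma EForms_subset (μ : Measure (Config X)) [IsProbabilityMeasure μ] (n : ℕ) :
    EForms d X n ⊆ L2Forms μ n := by
  cases n with
  | zero =>
    rintro W ⟨F, ⟨N, g, φ, hg, hb, hφ, hF⟩, rfl⟩
    obtain ⟨C, hC⟩ := hb 0
    have hc : Continuous F := by
      have : F = fun γ => g (fun i => Config.pairing (φ i) γ) := funext hF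
      rw [this]
      exact hg.continuous.comp (continuous_pi fun i =>
        Config.continuous_pairing (hφ i).1.continuous (hφ i).2)
    refine MemLp.of_bound hc.measurable.aestronglyMeasurable C
      (Filter.Eventually.of_forall fun γ => ?_)
    have h := hC (fun i => Config.pairing (φ i) γ)
    rw [norm_iteratedFDeriv_zero, ← hF γ] at h
    exact h
  | succ n => exact fun W hW => hW.1

/-- The class in `L²_μ Ω^n` of an element of `𝓔Ω^n`. -/
def toL2 (μ : Measure (Config X)) [IsProbabilityMeasure μ] [HasFiniteMoments μ] {n : ℕ}
    (W : EForms d X n) : L2Space d μ n :=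
  UniformSpace.Completion.coe' (α := PreL2 (d := d) μ n)
    ⟨W.1, Submodule.subset_span (EForms_subset μ n W.2)⟩

/-! ### The Hilbert complex

Unbounded operators are handled through their graphs: the closure of an operator is given by the
closure of its graph, the adjoint by `Submodule.adjoint`.  `graphKer` is `{h | (h, 0) ∈ T}`. -/

section Operators

variable {H K : Type*} [AddCommGroup H] [Module ℝ H] [AddCommGroup K] [Module ℝ K]

/-- Kernel of the operator with graph `T`. -/
def graphKer (T : Submodule ℝ (H × K)) : Submodule ℝ H := T.comap (LinearMap.inl ℝ H K)

/-- Range of the operator with graph `T`. -/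
def graphRange (T : Submodule ℝ (H × K)) : Submodule ℝ K := T.map (LinearMap.snd ℝ H K)

end Operators

variable (d)
variable (μ : Measure (Config X)) [IsProbabilityMeasure μ] [HasFiniteMoments μ]

/-- Graph of `d_n : 𝓔Ω^n → 𝓔Ω^{n+1}`, as an operator from `L²_μ Ω^n` into `L²_μ Ω^{n+1}`: the pairs
of classes of `W` and `d_n W`.  (These pairs form a linear subspace; `span` only records this.) -/
def dGraph (n : ℕ) : Submodule ℝ (L2Space d μ n × L2Space d μ (n + 1)) :=
  Submodule.span ℝ {q | ∃ (W : EForms d X n) (V : EForms d X (n + 1)),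
    V.1 = extD W.1 ∧ q = (toL2 μ W, toL2 μ V)}

/-- Graph of the closure `d̄_n`. -/
def dBar (n : ℕ) : Submodule ℝ (L2Space d μ n × L2Space d μ (n + 1)) :=
  (dGraph d μ n).topologicalClosure

/-- Graph of the adjoint `d_n^*`. -/
def dStar (n : ℕ) : Submodule ℝ (L2Space d μ (n + 1) × L2Space d μ n) :=
  (dGraph d μ n).adjoint

/-- `Z^n = Ker d̄_n`. -/
def cocycles (n : ℕ) : Submodule ℝ (L2Space d μ n) := graphKer (dBar d μ n)

/-- `B^{n+1}`, the closure of `Im d_n`. -/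
def coboundaries (n : ℕ) : Submodule ℝ (L2Space d μ (n + 1)) :=
  (graphRange (dGraph d μ n)).topologicalClosure

/-- The `L²`-cohomology `ℋ^{n+1}_μ = Z^{n+1} / B^{n+1}`, with the quotient norm. -/
abbrev L2Cohomology (n : ℕ) : Type _ :=
  cocycles d μ (n + 1) ⧸ (coboundaries d μ n).submoduleOf (cocycles d μ (n + 1))

/-- Graph of the Hodge-deRham Laplacian in degree `n + 1`, the generator of the form
`𝓔(W, W') = (d̄_{n+1} W, d̄_{n+1} W') + (d_n^* W, d_n^* W')` with domain `D(d̄_{n+1}) ∩ D(d_n^*)`: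
`H W = V` means that `W` is in the domain of the form and `𝓔(W, W') = (V, W')` for all `W'` in this
domain. -/
def hodgeLaplacian (n : ℕ) : Submodule ℝ (L2Space d μ (n + 1) × L2Space d μ (n + 1)) where
  carrier := {q | ∃ a b, (q.1, a) ∈ dBar d μ (n + 1) ∧ (q.1, b) ∈ dStar d μ n ∧
    ∀ W' a' b', (W', a') ∈ dBar d μ (n + 1) → (W', b') ∈ dStar d μ n →
      inner ℝ a a' + inner ℝ b b' = inner ℝ q.2 W'}
  add_mem' := by
    rintro ⟨W, V⟩ ⟨W₁, V₁⟩ ⟨a, b, ha, hb, h⟩ ⟨a₁, b₁, ha₁, hb₁, h₁⟩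
    refine ⟨a + a₁, b + b₁, add_mem ha ha₁, add_mem hb hb₁, fun W' a' b' ha' hb' => ?_⟩
    have e := h W' a' b' ha' hb'
    have e₁ := h₁ W' a' b' ha' hb'
    simp only [Prod.mk_add_mk, inner_add_left] at e e₁ ⊢
    linarith
  zero_mem' := ⟨0, 0, zero_mem _, zero_mem _, fun _ _ _ _ _ => by simp⟩
  smul_mem' := by
    rintro c ⟨W, V⟩ ⟨a, b, ha, hb, h⟩
    refine ⟨c • a, c • b, Submodule.smul_mem _ c ha, Submodule.smul_mem _ c hb,
      fun W' a' b' ha' hb' => ?_⟩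
    have e := h W' a' b' ha' hb'
    simp only [Prod.smul_mk, real_inner_smul_left] at e ⊢
    rw [← mul_add, e]

/-- The space `Ker H^R_{μ,n+1}` of harmonic forms of degree `n + 1`. -/
def harmonic (n : ℕ) : Submodule ℝ (L2Space d μ (n + 1)) := graphKer (hodgeLaplacian d μ n)

end Riemannian

/-! ### The condition `Σ'_m` and the logarithmic derivative of `μ` -/

section Sigma

variable [MetricSpace X] [ChartedSpace (EuclideanSpace ℝ (Fin d)) X]
  [IsManifold (𝓡 d) ∞ X]
  [RiemannianBundle (fun x : X => TangentSpace (𝓡 d) x)]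
  [MeasurableSpace X] [BorelSpace X]

/-- The condition `Σ'_m` for `μ`, with `σ(γ, dx) = ρ(γ, x) m(dx)`, where `m` is the Riemannian
volume (the normalized `d`-dimensional Hausdorff measure of the Riemannian distance). -/
structure SigmaCondition (d : ℕ) (μ : Measure (Config X)) (ρ : Config X → X → ℝ) : Prop where
  measurable : Measurable fun q : Config X × X => ρ q.1 q.2
  nonneg : ∀ γ x, 0 ≤ ρ γ x
  mecke : ∀ F : Config X × X → ℝ≥0∞, Measurable F →
    ∫⁻ γ, ∑' x : γ.carrier, F (γ, x) ∂μ =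
      ∫⁻ γ, ∫⁻ x, F (γ.add x, x) * ENNReal.ofReal (ρ γ x) ∂(μHE[d] : Measure X) ∂μ

/-- `G` is the weak gradient of `f : X → ℝ`: in every preferred chart, `f` and `G` are locally
integrable and the coordinate expression of `⟨G, ·⟩` is the weak differential of that of `f`. -/
def IsWeakGradient (f : X → ℝ) (G : (x : X) → TangentSpace (𝓡 d) x) : Prop :=
  ∀ p : X,
    LocallyIntegrableOn (fun z => f (chartPt p z))
      (chartAt (EuclideanSpace ℝ (Fin d)) p).target volume ∧
    ∀ v : EuclideanSpace ℝ (Fin d),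
      LocallyIntegrableOn (fun z => inner ℝ (G (chartPt p z)) (frame p (chartPt p z) v))
        (chartAt (EuclideanSpace ℝ (Fin d)) p).target volume ∧
      ∀ ψ : EuclideanSpace ℝ (Fin d) → ℝ, ContDiff ℝ ∞ ψ → HasCompactSupport ψ →
        tsupport ψ ⊆ (chartAt (EuclideanSpace ℝ (Fin d)) p).target →
        ∫ z, f (chartPt p z) * fderiv ℝ ψ z v =
          - ∫ z, inner ℝ (G (chartPt p z)) (frame p (chartPt p z) v) * ψ z

/-- The logarithmic derivative `B_μ(γ, x) = β_σ(γ - ε_x, x)`, where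
`β_σ(γ, x) = ∇_x ρ(γ, x) / ρ(γ, x)`. -/
def logDeriv (ρ : Config X → X → ℝ) (G : Config X → (x : X) → TangentSpace (𝓡 d) x)
    (γ : Config X) (x : X) : TangentSpace (𝓡 d) x :=
  (ρ (γ.erase x) x)⁻¹ • G (γ.erase x) x

/-- `ρ` is positive and weakly differentiable with weak gradient `G`, and
`∑_{x ∈ γ_Λ} |B_μ(γ, x)|` is in `L^{2+ε}(μ)`, for every open relatively compact `Λ` and some
`ε > 0` depending on `Λ`. -/
structure LogDerivCondition (d : ℕ) [ChartedSpace (EuclideanSpace ℝ (Fin d)) X]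
    [IsManifold (𝓡 d) ∞ X] [RiemannianBundle (fun x : X => TangentSpace (𝓡 d) x)]
    (μ : Measure (Config X)) (ρ : Config X → X → ℝ)
    (G : Config X → (x : X) → TangentSpace (𝓡 d) x) : Prop where
  pos : ∀ᵐ γ ∂μ, ∀ᵐ x ∂(μHE[d] : Measure X), 0 < ρ γ x
  weakGradient : ∀ᵐ γ ∂μ, IsWeakGradient (ρ γ) (G γ)
  measurable : Measurable fun q : Config X × X => ‖G q.1 q.2‖
  moment : ∀ Λ : Set X, IsOpen Λ → IsCompact (closure Λ) → ∃ ε : ℝ, 0 < ε ∧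
    ∫⁻ γ, (∑' x : (γ.restrict Λ).carrier,
      ENNReal.ofReal ‖logDeriv ρ G γ x‖) ^ (2 + ε) ∂μ < ⊤

end Sigma

end ConfigForms

end

/-!
The algebraic heart of the statement is `extD_extD`: the differential over the configuration space
squares to zero, pointwise. Fix a component of a form at a configuration `γ` and split off from `γ`
the finitely many points `p_1, …, p_m` carrying its indices. With the rest `η` of `γ` frozen, a
form `W` restricts to an ordinary differential form on a neighbourhood of `(p_1, …, p_m)` in `X^m`,
which the preferred charts turn into the form `localForm` on an open subset of `(ℝ^d)^m`. Since the
`p_j` are distinct and off `η`, the smooth extensions which belong to the definition of `𝓔Ω^n`, or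
the cylinder representation if `n = 0`, make `localForm` jointly smooth
(`isJointlySmooth_of_mem_EForms`).

At the centres of the charts, `√(n+1) AS ∇^Γ W` is `√(n+1) / (n+1)` times the exterior derivative
of `localForm`, because the Levi-Civita connection is torsion-free, so that the Christoffel terms
are killed by antisymmetrization (`extD_addPts`). The covariant derivative at a point is read in the
preferred chart at this very point. To differentiate twice, the identity is needed in a
neighbourhood, in a fixed chart; it is carried there by the naturality of the exterior derivative
under the transition maps (`localForm_extD`). Then `d² = 0` on `(ℝ^d)^m` concludes.

Hence `B^{n+1} ⊆ Z^{n+1}`, since `Z^{n+1}` is closed. The rest is Hilbert space theory of a linear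
relation `T` and its adjoint: the kernel of the closure of `T` is the orthogonal complement of the
range of the adjoint (`graphRange_adjoint_orthogonal`), because the double adjoint is the closure;
the kernel of the adjoint is the orthogonal complement of the range of `T` (`graphKer_adjoint`). The
quadratic form vanishes on harmonic elements, so these are the elements of `Z^{n+1}` orthogonal to
`B^{n+1}` (`harmonic_eq`). The decomposition and the isometry with the quotient follow by orthogonal
projection. Closability of the differential plays no role, as operators are handled through
their graphs.
-/

noncomputable section

namespace ConfigForms

/-! ### Alternating forms on a finite-dimensional space -/

section Multilinear

variable {V : Type*} [NormedAddCommGroup V] [NormedSpace ℝ V] {n : ℕ}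

lemma continuous_of_multilinear [FiniteDimensional ℝ V]
    (f : MultilinearMap ℝ (fun _ : Fin n => V) ℝ) : Continuous f := by
  let e := Module.finBasis ℝ V
  have h : ∀ ξ : Fin n → V, f ξ = ∑ r : Fin n → Fin (Module.finrank ℝ V),
      (∏ i, e.coord (r i) (ξ i)) * f fun i => e (r i) := by
    intro ξ
    conv_lhs => rw [show ξ = fun i => ∑ k, e.coord k (ξ i) • e k from
      funext fun i => (e.sum_repr (ξ i)).symm]
    rw [f.map_sum]
    exact Finset.sum_congr rfl fun r _ => f.map_smul_univ _ _
  have hc : ∀ k, Continuous (e.coord k) := fun k => LinearMap.continuous_of_finiteDimensional _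
  rw [show (f : (Fin n → V) → ℝ) = _ from funext h]
  exact continuous_finsetSum _ fun r _ =>
    (continuous_finsetProd _ fun i _ => (hc (r i)).comp (continuous_apply i)).mul continuous_const

instance [FiniteDimensional ℝ V] : FiniteDimensional ℝ (V [⋀^Fin n]→L[ℝ] ℝ) :=
  Module.Finite.of_injective
    ({ toFun := fun g => g.toMultilinearMap
       map_add' := fun _ _ => rfl
       map_smul' := fun _ _ => rfl } :
      (V [⋀^Fin n]→L[ℝ] ℝ) →ₗ[ℝ] MultilinearMap ℝ (fun _ : Fin n => V) ℝ)
    (ContinuousMultilinearMap.toMultilinearMap_injective.comp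
      ContinuousAlternatingMap.toContinuousMultilinearMap_injective)

/-- Smoothness of a field of alternating forms can be tested on constant vectors. -/
lemma contDiffAt_of_forall_apply [FiniteDimensional ℝ V] {Z : Type*} [NormedAddCommGroup Z]
    [NormedSpace ℝ Z] {f : Z → V [⋀^Fin n]→L[ℝ] ℝ} {z : Z} {r : WithTop ℕ∞}
    (h : ∀ ξ, ContDiffAt ℝ r (fun z => f z ξ) z) : ContDiffAt ℝ r f z := by
  let e := Module.finBasis ℝ V
  let ev : (V [⋀^Fin n]→L[ℝ] ℝ) →ₗ[ℝ] ((Fin n → Fin (Module.finrank ℝ V)) → ℝ) :=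
    { toFun := fun g r => g fun i => e (r i)
      map_add' := fun _ _ => rfl
      map_smul' := fun _ _ => rfl }
  have hev : LinearMap.ker ev = ⊥ := by
    refine LinearMap.ker_eq_bot.2 fun g g' hg => ?_
    exact ContinuousAlternatingMap.toAlternatingMap_injective
      (Module.Basis.ext_alternating e fun r _ => congrFun hg r)
  obtain ⟨L, hL⟩ := LinearMap.exists_leftInverse_of_injective ev hev
  have hf : f = fun z => LinearMap.toContinuousLinearMap L (ev (f z)) :=
    funext fun z => (LinearMap.congr_fun hL (f z)).symm
  rw [hf]
  exact (LinearMap.toContinuousLinearMap L).contDiff.contDiffAt.comp z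
    (contDiffAt_pi.2 fun r => h fun i => e (r i))

/-- The signed sum over all permutations is `n!` times the signed sum over the choices of the
argument in the first slot. -/
lemma sum_sign_mul_eq_alternatizeUncurryFin (f : V →L[ℝ] V [⋀^Fin n]→L[ℝ] ℝ) (v : Fin (n + 1) → V) :
    ∑ σ : Equiv.Perm (Fin (n + 1)), ((Equiv.Perm.sign σ : ℤ) : ℝ) *
        f (v (σ 0)) (fun i => v (σ i.succ)) =
      n.factorial * ContinuousAlternatingMap.alternatizeUncurryFin f v := by
  set A := ContinuousAlternatingMap.alternatizeUncurryFin f with hA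
  set S := ∑ σ : Equiv.Perm (Fin (n + 1)), ((Equiv.Perm.sign σ : ℤ) : ℝ) *
        f (v (σ 0)) (fun i => v (σ i.succ)) with hS
  have h1 : ∑ σ : Equiv.Perm (Fin (n + 1)), ((Equiv.Perm.sign σ : ℤ) : ℝ) *
      A (fun i => v (σ i)) = (n + 1).factorial * A v := by
    have : ∀ σ : Equiv.Perm (Fin (n + 1)), ((Equiv.Perm.sign σ : ℤ) : ℝ) *
        A (fun i => v (σ i)) = A v := by
      intro σ
      have := A.toAlternatingMap.map_perm v σ
      rw [Units.smul_def, zsmul_eq_mul] at this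
      change ((Equiv.Perm.sign σ : ℤ) : ℝ) * A.toAlternatingMap (v ∘ σ) = A.toAlternatingMap v
      rw [this, ← mul_assoc, ← Int.cast_mul, Int.units_coe_mul_self]
      simp
    simp [this, Fintype.card_perm]
  have h2 : ∑ σ : Equiv.Perm (Fin (n + 1)), ((Equiv.Perm.sign σ : ℤ) : ℝ) *
      A (fun i => v (σ i)) = (n + 1) * S := by
    have h3 : ∀ k : Fin (n + 1), ∑ σ : Equiv.Perm (Fin (n + 1)), ((Equiv.Perm.sign σ : ℤ) : ℝ) *
        ((-1) ^ (k : ℕ) * f (v (σ k)) (fun i => v (σ (k.succAbove i)))) = S := by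
      intro k
      rw [hS]
      refine (Equiv.sum_comp (Equiv.mulRight k.cycleRange) _).symm.trans ?_
      refine Finset.sum_congr rfl fun σ _ => ?_
      simp only [Equiv.coe_mulRight, Equiv.Perm.sign_mul, Fin.sign_cycleRange, Equiv.Perm.coe_mul,
        Function.comp_apply, Fin.cycleRange_self, Fin.cycleRange_succAbove]
      push_cast
      rw [mul_assoc, ← mul_assoc ((-1 : ℝ) ^ (k : ℕ)), ← mul_pow]
      simp
    simp only [hA, ContinuousAlternatingMap.alternatizeUncurryFin_apply, Finset.mul_sum]
    rw [Finset.sum_comm]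
    calc _ = ∑ k : Fin (n + 1), S := Finset.sum_congr rfl fun k _ => by
            rw [← h3 k]
            refine Finset.sum_congr rfl fun σ _ => ?_
            simp
            rfl
      _ = _ := by simp
  rw [h2, Nat.factorial_succ] at h1
  push_cast at h1
  have h0 : (n + 1 : ℝ) ≠ 0 := by positivity
  exact mul_left_cancel₀ h0 (by linarith)

/-- Antisymmetrization kills whatever is symmetric in two slots. -/
lemma sum_sign_mul_eq_zero {i j : Fin n} (hij : i ≠ j) (g : Equiv.Perm (Fin n) → ℝ)
    (hg : ∀ σ, g (σ * Equiv.swap i j) = g σ) :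
    ∑ σ : Equiv.Perm (Fin n), ((Equiv.Perm.sign σ : ℤ) : ℝ) * g σ = 0 := by
  have h := Equiv.sum_comp (Equiv.mulRight (Equiv.swap i j))
    (fun σ : Equiv.Perm (Fin n) => ((Equiv.Perm.sign σ : ℤ) : ℝ) * g σ)
  simp only [Equiv.coe_mulRight, Equiv.Perm.sign_mul, Equiv.Perm.sign_swap hij, hg] at h
  simp only [mul_neg, mul_one, Units.val_neg, Int.cast_neg, neg_mul, Finset.sum_neg_distrib] at h
  linarith

end Multilinear

/-! ### Charts and coordinate frames -/

section Charts

variable {d : ℕ} {X : Type*} [TopologicalSpace X] [ChartedSpace (EuclideanSpace ℝ (Fin d)) X]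

lemma chartPt_chartCenter (p : X) : chartPt p (chartCenter (d := d) p) = p :=
  (chartAt (EuclideanSpace ℝ (Fin d)) p).left_inv (mem_chart_source _ p)

lemma chartCenter_mem_target (p : X) :
    chartCenter (d := d) p ∈ (chartAt (EuclideanSpace ℝ (Fin d)) p).target :=
  mem_chart_target _ p

lemma eventually_mem_chart_target (p : X) :
    ∀ᶠ z in 𝓝 (chartCenter (d := d) p), z ∈ (chartAt (EuclideanSpace ℝ (Fin d)) p).target :=
  (chartAt _ p).open_target.mem_nhds (chartCenter_mem_target p)

lemma continuousAt_chartPt {p : X} {z : EuclideanSpace ℝ (Fin d)}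
    (hz : z ∈ (chartAt (EuclideanSpace ℝ (Fin d)) p).target) : ContinuousAt (chartPt p) z :=
  (chartAt _ p).continuousAt_symm hz

lemma tendsto_chartPt (p : X) :
    Filter.Tendsto (chartPt p) (𝓝 (chartCenter (d := d) p)) (𝓝 p) := by
  have h := (continuousAt_chartPt (chartCenter_mem_target (d := d) p)).tendsto
  rwa [chartPt_chartCenter] at h

lemma chartPt_mem_source {p : X} {z : EuclideanSpace ℝ (Fin d)}
    (hz : z ∈ (chartAt (EuclideanSpace ℝ (Fin d)) p).target) :
    chartPt p z ∈ (chartAt (EuclideanSpace ℝ (Fin d)) p).source :=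
  (chartAt _ p).map_target hz

lemma chartAt_chartPt {p : X} {z : EuclideanSpace ℝ (Fin d)}
    (hz : z ∈ (chartAt (EuclideanSpace ℝ (Fin d)) p).target) :
    chartAt (EuclideanSpace ℝ (Fin d)) p (chartPt p z) = z :=
  (chartAt _ p).right_inv hz

variable [IsManifold (𝓡 d) ∞ X]

/-- `frame p y` as a linear map. -/
def frameMap (p y : X) : EuclideanSpace ℝ (Fin d) →ₗ[ℝ] TangentSpace (𝓡 d) y :=
  ((trivializationAt (EuclideanSpace ℝ (Fin d))
    (TangentSpace (𝓡 d) (M := X)) p).symmL ℝ y).toLinearMap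

lemma frame_eq_tangentCoordChange {p y : X}
    (hy : y ∈ (chartAt (EuclideanSpace ℝ (Fin d)) p).source) (w : EuclideanSpace ℝ (Fin d)) :
    frame p y w = tangentCoordChange (𝓡 d) p y y w := by
  unfold frame
  rw [TangentBundle.symmL_trivializationAt_eq_core hy]
  rfl

lemma frame_self (p : X) (w : EuclideanSpace ℝ (Fin d)) : frame p p w = w := by
  rw [frame_eq_tangentCoordChange (mem_chart_source _ p)]
  exact tangentCoordChange_self (E := EuclideanSpace ℝ (Fin d)) (I := 𝓡 d) (x := p) (z := p) (v := w)
    (mem_extChartAt_source p)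

lemma frame_tangentCoordChange {p q y : X}
    (hp : y ∈ (chartAt (EuclideanSpace ℝ (Fin d)) p).source)
    (hq : y ∈ (chartAt (EuclideanSpace ℝ (Fin d)) q).source) (w : EuclideanSpace ℝ (Fin d)) :
    frame q y (tangentCoordChange (𝓡 d) p q y w) = frame p y w := by
  rw [frame_eq_tangentCoordChange hp, frame_eq_tangentCoordChange hq]
  exact tangentCoordChange_comp (E := EuclideanSpace ℝ (Fin d)) (I := 𝓡 d) (w := p) (x := q)
    (y := y) (z := y) (v := w) (by simp [hp, hq])

lemma contDiffAt_chart_transition {p q : X} {z : EuclideanSpace ℝ (Fin d)}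
    (hz : z ∈ (chartAt (EuclideanSpace ℝ (Fin d)) p).target)
    (hq : chartPt p z ∈ (chartAt (EuclideanSpace ℝ (Fin d)) q).source) :
    ContDiffAt ℝ ∞ (fun z => chartAt (EuclideanSpace ℝ (Fin d)) q (chartPt p z)) z := by
  have h := contDiffWithinAt_ext_coord_change (I := 𝓡 d) (n := ∞) q p (y := z)
    (by simpa [hz, chartPt] using hq)
  simpa [Function.comp_def, chartPt, contDiffWithinAt_univ] using! h

lemma hasFDerivAt_chart_transition {p q : X} {z : EuclideanSpace ℝ (Fin d)}
    (hz : z ∈ (chartAt (EuclideanSpace ℝ (Fin d)) p).target)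
    (hq : chartPt p z ∈ (chartAt (EuclideanSpace ℝ (Fin d)) q).source) :
    HasFDerivAt (fun z => chartAt (EuclideanSpace ℝ (Fin d)) q (chartPt p z))
      (tangentCoordChange (𝓡 d) p q (chartPt p z)) z := by
  have h := hasFDerivWithinAt_tangentCoordChange (I := 𝓡 d) (x := p) (y := q) (z := chartPt p z)
    (by simpa [hq] using chartPt_mem_source hz)
  have h' : extChartAt (𝓡 d) p (chartPt p z) = z := by simpa using! chartAt_chartPt hz
  rw [h'] at h
  simpa [Function.comp_def, chartPt, hasFDerivWithinAt_univ] using! h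

end Charts

/-! ### Coordinate expressions of forms in several moving points -/

section Points

variable {X : Type*} [TopologicalSpace X]

/-- The points `p_1, …, p_m` are distinct and do not belong to the configuration `η`. -/
def IsFresh {m : ℕ} (η : Config X) (p : Fin m → X) : Prop :=
  Function.Injective p ∧ ∀ j, p j ∉ η.carrier

lemma isClosed_carrier [T2Space X] [LocallyCompactSpace X] (η : Config X) :
    IsClosed η.carrier := by
  refine isOpen_compl_iff.1 (isOpen_iff_mem_nhds.2 fun x hx => ?_)
  obtain ⟨K, hK, hxK⟩ := exists_compact_mem_nhds x
  have hfin : (η.carrier ∩ K)ᶜ ∈ 𝓝 x :=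
    (η.finite_inter K hK).isClosed.isOpen_compl.mem_nhds fun h => hx h.1
  filter_upwards [hxK, hfin] with y hyK hy hyη using hy ⟨hyη, hyK⟩

lemma eventually_isFresh [T2Space X] [LocallyCompactSpace X] {m : ℕ} {η : Config X}
    {p : Fin m → X} (hp : IsFresh η p) : ∀ᶠ y in 𝓝 p, IsFresh η y := by
  have h1 : ∀ᶠ y in 𝓝 p, ∀ i j : Fin m, i ≠ j → y i ≠ y j := by
    refine Filter.eventually_all.2 fun i => Filter.eventually_all.2 fun j => ?_
    by_cases hij : i = j
    · exact Filter.Eventually.of_forall fun y h => (h hij).elim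
    · have ho : IsOpen {y : Fin m → X | y i ≠ y j} :=
        isOpen_ne_fun (continuous_apply i) (continuous_apply j)
      filter_upwards [ho.mem_nhds fun h => hij (hp.1 h)] with y hy _ using hy
  have h2 : ∀ᶠ y in 𝓝 p, ∀ j : Fin m, y j ∉ η.carrier :=
    Filter.eventually_all.2 fun j =>
      (continuous_apply j).continuousAt.eventually
        ((isClosed_carrier η).isOpen_compl.mem_nhds (hp.2 j))
  filter_upwards [h1, h2] with y hy1 hy2
  exact ⟨fun i j h => by_contra fun hij => hy1 i j hij h, hy2⟩

/-- Moving one of the fresh points. -/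
lemma move_addPts {m : ℕ} {η : Config X} {p : Fin m → X} (hp : IsFresh η p) (j : Fin m) (y : X) :
    (η.addPts p).move (p j) y = η.addPts (Function.update p j y) := by
  ext x
  simp only [Config.move, Config.add, Config.addPts, Config.erase, mem_union, mem_sdiff, mem_range,
    mem_singleton_iff]
  constructor
  · rintro (⟨h | ⟨i, rfl⟩, h2⟩ | ⟨_, rfl⟩)
    · exact Or.inl h
    · refine Or.inr ⟨i, ?_⟩
      rw [Function.update_of_ne]
      rintro rfl
      exact h2 rfl
    · exact Or.inr ⟨j, by simp⟩
  · rintro (h | ⟨i, rfl⟩)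
    · exact Or.inl ⟨Or.inl h, fun h' => hp.2 j (h' ▸ h)⟩
    · by_cases hij : i = j
      · subst hij
        exact Or.inr ⟨0, by simp⟩
      · rw [Function.update_of_ne hij]
        exact Or.inl ⟨Or.inr ⟨i, rfl⟩, fun h => hij (hp.1 h)⟩

/-- Any finite set of points of a configuration can be split off from it. -/
lemma exists_eq_addPts {γ : Config X} {k : ℕ} {x : Fin k → X}
    (hx : ∀ i, x i ∈ γ.carrier) : ∃ (m : ℕ) (η : Config X) (p : Fin m → X) (b : Fin k → Fin m),
      IsFresh η p ∧ γ = η.addPts p ∧ x = fun i => p (b i) := by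
  obtain ⟨m, ⟨e⟩⟩ := Finite.exists_equiv_fin (range x)
  refine ⟨m, ⟨γ.carrier \ range x, fun K hK => (γ.finite_inter K hK).subset
    fun y hy => ⟨hy.1.1, hy.2⟩⟩, fun j => e.symm j, fun i => e ⟨x i, mem_range_self i⟩,
    ⟨fun i j h => e.symm.injective (Subtype.ext h), fun j h => h.2 (e.symm j).2⟩, ?_, ?_⟩
  · have hr : range (fun j => (e.symm j : X)) = range x := by
      rw [show (fun j => (e.symm j : X)) = Subtype.val ∘ e.symm from rfl,
        e.symm.surjective.range_comp, Subtype.range_val]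
    ext y
    simp only [Config.addPts, hr, sdiff_union_self, mem_union]
    exact ⟨Or.inl, fun h => h.elim id fun ⟨i, hi⟩ => hi ▸ hx i⟩
  · funext i
    simp

lemma pairing_addPts {m : ℕ} {φ : X → ℝ} (hφ : HasCompactSupport φ) {η : Config X}
    {y : Fin m → X} (hy : IsFresh η y) :
    Config.pairing φ (η.addPts y) = Config.pairing φ η + ∑ j, φ (y j) := by
  have hdisj : Disjoint η.carrier (range y) :=
    Set.disjoint_left.2 fun x hx ⟨j, hj⟩ => hy.2 j (hj ▸ hx)
  have h1 : (η.carrier ∩ Function.support φ).Finite :=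
    (η.finite_inter _ hφ).subset (inter_subset_inter_right _ (subset_tsupport φ))
  have h2 : (range y ∩ Function.support φ).Finite := (finite_range y).subset inter_subset_left
  change ∑ᶠ x ∈ η.carrier ∪ range y, φ x = _
  rw [finsum_mem_union' hdisj h1 h2, finsum_mem_range hy.1, finsum_eq_sum_of_fintype fun j => φ (y j)]
  rfl

end Points

section LocalForm

variable {d : ℕ} {X : Type*} [TopologicalSpace X] [ChartedSpace (EuclideanSpace ℝ (Fin d)) X]
  [IsManifold (𝓡 d) ∞ X] [RiemannianBundle (fun x : X => TangentSpace (𝓡 d) x)] {n m : ℕ}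

/-- The points whose coordinates in the preferred charts at `p_1, …, p_m` are `z_1, …, z_m`. -/
def chartPts (p : Fin m → X) (z : Fin m → EuclideanSpace ℝ (Fin d)) : Fin m → X :=
  fun j => chartPt (p j) (z j)

/-- The coordinates of the points `p_j` in the preferred charts at these same points. -/
def chartCenters (p : Fin m → X) : Fin m → EuclideanSpace ℝ (Fin d) := fun j => chartCenter (p j)

omit [IsManifold (𝓡 d) ∞ X] [RiemannianBundle (fun x : X => TangentSpace (𝓡 d) x)] in
lemma chartPts_chartCenters (p : Fin m → X) : chartPts p (chartCenters (d := d) p) = p :=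
  funext fun j => chartPt_chartCenter (p j)

omit [IsManifold (𝓡 d) ∞ X] [RiemannianBundle (fun x : X => TangentSpace (𝓡 d) x)] in
lemma tendsto_chartPts (p : Fin m → X) :
    Filter.Tendsto (chartPts p) (𝓝 (chartCenters (d := d) p)) (𝓝 p) :=
  tendsto_pi_nhds.2 fun j => (tendsto_chartPt (p j)).comp (continuous_apply j).continuousAt

omit [IsManifold (𝓡 d) ∞ X] [RiemannianBundle (fun x : X => TangentSpace (𝓡 d) x)] in
lemma eventually_chartPts [T2Space X] {η : Config X} {p : Fin m → X} (hp : IsFresh η p) :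
    ∀ᶠ z in 𝓝 (chartCenters (d := d) p), IsFresh η (chartPts p z) ∧
      ∀ j, z j ∈ (chartAt (EuclideanSpace ℝ (Fin d)) (p j)).target := by
  have : LocallyCompactSpace X := ChartedSpace.locallyCompactSpace (EuclideanSpace ℝ (Fin d)) X
  exact ((tendsto_chartPts p).eventually (eventually_isFresh hp)).and
    (Filter.eventually_all.2 fun j =>
      (continuous_apply j).continuousAt.eventually (eventually_mem_chart_target (p j)))

/-- The component of index `(p_{b 1}, …, p_{b n})` of `W`, in the preferred charts at the `p_j`, as
a function of the coordinates of the moving points `p_1, …, p_m`; the points of `η` stay fixed. -/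
def localComp (W : TensorField d X n) (η : Config X) (p : Fin m → X) (b : Fin n → Fin m)
    (u : Fin n → EuclideanSpace ℝ (Fin d)) (z : Fin m → EuclideanSpace ℝ (Fin d)) : ℝ :=
  W (η.addPts (chartPts p z)) (fun i => chartPts p z (b i))
    (fun i => frame (p (b i)) (chartPts p z (b i)) (u i))

/-- The components of `W` depend smoothly on any finite family of points, jointly. -/
def IsJointlySmooth (W : TensorField d X n) : Prop :=
  ∀ (η : Config X) (m : ℕ) (p : Fin m → X), IsFresh η p → ∀ (b : Fin n → Fin m)
    (u : Fin n → EuclideanSpace ℝ (Fin d)), ContDiffAt ℝ ∞ (localComp W η p b u) (chartCenters p)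

/-- The restriction of `W` to `⨁_j T_{p_j} X`, in coordinates, as a multilinear map. -/
def localMultilinear {W : TensorField d X n} (hW : IsForm W) (η : Config X) (p : Fin m → X)
    (z : Fin m → EuclideanSpace ℝ (Fin d)) :
    MultilinearMap ℝ (fun _ : Fin n => Fin m → EuclideanSpace ℝ (Fin d)) ℝ :=
  ∑ b : Fin n → Fin m,
    (hW.multilinear (η.addPts (chartPts p z)) (fun i => chartPts p z (b i))).choose.compLinearMap
      fun i => (frameMap (p (b i)) (chartPts p z (b i))).comp (LinearMap.proj (b i))

lemma localMultilinear_apply {W : TensorField d X n} (hW : IsForm W) (η : Config X)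
    (p : Fin m → X) (z : Fin m → EuclideanSpace ℝ (Fin d))
    (ξ : Fin n → Fin m → EuclideanSpace ℝ (Fin d)) :
    localMultilinear hW η p z ξ = ∑ b : Fin n → Fin m, localComp W η p b (fun i => ξ i (b i)) z := by
  rw [localMultilinear, _root_.sum_apply]
  refine Finset.sum_congr rfl fun b _ => ?_
  rw [MultilinearMap.compLinearMap_apply]
  exact ((hW.multilinear (η.addPts (chartPts p z)) (fun i => chartPts p z (b i))).choose_spec
    _).symm

lemma localMultilinear_perm {W : TensorField d X n} (hW : IsForm W) (η : Config X)
    (p : Fin m → X) (z : Fin m → EuclideanSpace ℝ (Fin d))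
    (ξ : Fin n → Fin m → EuclideanSpace ℝ (Fin d)) (σ : Equiv.Perm (Fin n)) :
    localMultilinear hW η p z (fun i => ξ (σ i)) =
      ((Equiv.Perm.sign σ : ℤ) : ℝ) * localMultilinear hW η p z ξ := by
  rw [localMultilinear_apply, localMultilinear_apply, Finset.mul_sum,
    ← Equiv.sum_comp (Equiv.arrowCongr σ.symm (Equiv.refl (Fin m)))]
  exact Finset.sum_congr rfl fun b _ => hW.alternating (η.addPts (chartPts p z))
    (fun i => chartPts p z (b i)) (fun i => frame (p (b i)) (chartPts p z (b i)) (ξ i (b i))) σ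

/-- The restriction of `W` to the `m` moving points `p_j`, in the preferred charts at these points:
a differential form of degree `n` on an open subset of `(ℝ^d)^m`. -/
def localForm {W : TensorField d X n} (hW : IsForm W) (η : Config X) (p : Fin m → X)
    (z : Fin m → EuclideanSpace ℝ (Fin d)) :
    (Fin m → EuclideanSpace ℝ (Fin d)) [⋀^Fin n]→L[ℝ] ℝ where
  toMultilinearMap := localMultilinear hW η p z
  cont := continuous_of_multilinear _
  map_eq_zero_of_eq' ξ i j hξ hij := by
    have h := localMultilinear_perm hW η p z ξ (Equiv.swap i j)
    have e : (fun k => ξ (Equiv.swap i j k)) = ξ := by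
      funext k
      rcases eq_or_ne k i with rfl | hi
      · rw [Equiv.swap_apply_left, hξ]
      rcases eq_or_ne k j with rfl | hj
      · rw [Equiv.swap_apply_right, hξ]
      rw [Equiv.swap_apply_of_ne_of_ne hi hj]
    rw [e, Equiv.Perm.sign_swap hij] at h
    simp only [Units.val_neg, Units.val_one, Int.cast_neg, Int.cast_one, neg_mul, one_mul] at h
    change localMultilinear hW η p z ξ = 0
    linarith

lemma localForm_apply {W : TensorField d X n} (hW : IsForm W) (η : Config X)
    (p : Fin m → X) (z : Fin m → EuclideanSpace ℝ (Fin d))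
    (ξ : Fin n → Fin m → EuclideanSpace ℝ (Fin d)) :
    localForm hW η p z ξ = ∑ b : Fin n → Fin m, localComp W η p b (fun i => ξ i (b i)) z :=
  localMultilinear_apply hW η p z ξ

lemma localForm_single {W : TensorField d X n} (hW : IsForm W) (η : Config X)
    (p : Fin m → X) (z : Fin m → EuclideanSpace ℝ (Fin d)) (b : Fin n → Fin m)
    (u : Fin n → EuclideanSpace ℝ (Fin d)) :
    localForm hW η p z (fun i => Pi.single (b i) (u i)) = localComp W η p b u z := by
  rw [localForm_apply, Finset.sum_eq_single b]
  · simp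
  · intro c _ hc
    obtain ⟨i, hi⟩ := Function.ne_iff.1 hc
    obtain ⟨M, hM⟩ := hW.multilinear (η.addPts (chartPts p z)) (fun i => chartPts p z (c i))
    unfold localComp
    rw [hM]
    refine M.map_coord_zero i ?_
    beta_reduce
    rw [Pi.single_eq_of_ne hi]
    exact map_zero (frameMap (p (c i)) (chartPts p z (c i)))
  · simp

lemma contDiffAt_localForm {W : TensorField d X n} (hW : IsForm W) (hs : IsJointlySmooth W)
    {η : Config X} {p : Fin m → X} (hp : IsFresh η p) :
    ContDiffAt ℝ ∞ (localForm hW η p) (chartCenters p) := by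
  refine contDiffAt_of_forall_apply fun ξ => ?_
  simp only [localForm_apply]
  exact ContDiffAt.sum fun b _ => hs η m p hp b _

end LocalForm

/-! ### The differential in coordinates -/

section Differential

variable {d : ℕ} {X : Type*} [TopologicalSpace X] [ChartedSpace (EuclideanSpace ℝ (Fin d)) X]
  [IsManifold (𝓡 d) ∞ X] [RiemannianBundle (fun x : X => TangentSpace (𝓡 d) x)] {n m : ℕ}

omit [IsManifold (𝓡 d) ∞ X] [RiemannianBundle (fun x : X => TangentSpace (𝓡 d) x)] in
lemma tensorField_congr (W : TensorField d X n) {γ γ' : Config X} {x x' : Fin n → X}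
    {v v' : Fin n → EuclideanSpace ℝ (Fin d)} (hγ : γ = γ') (hx : x = x') (hv : v = v') :
    W γ x v = W γ' x' v' := by
  subst hγ hx hv; rfl

omit [RiemannianBundle (fun x : X => TangentSpace (𝓡 d) x)] in
lemma frame_congr {p p' y y' : X} (hp : p = p') (hy : y = y') (w : EuclideanSpace ℝ (Fin d)) :
    @Eq (EuclideanSpace ℝ (Fin d)) (frame p y w) (frame p' y' w) := by
  subst hp hy; rfl

/-- The Levi-Civita connection is torsion-free. -/
lemma christoffel_comm (p : X) (v w : TangentSpace (𝓡 d) p) :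
    christoffel p v w = christoffel p w v := by
  have h : metricCoeff p v w = metricCoeff p w v := funext fun z => real_inner_comm _ _
  unfold christoffel
  refine Finset.sum_congr rfl fun j _ => ?_
  rw [h]
  exact congrArg (fun t : ℝ => ((1 / 2 : ℝ) * (t -
    fderiv ℝ (metricCoeff p w v) (chartCenter p) (onb p j))) • onb p j) (add_comm _ _)

lemma christoffel_swap {p p' : X} (hp : p = p') (v w : EuclideanSpace ℝ (Fin d)) :
    @Eq (EuclideanSpace ℝ (Fin d)) (christoffel p v w) (christoffel p' w v) := by
  subst hp; exact christoffel_comm p v w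

/-- The covariant gradient in terms of the ordinary derivative of the coordinate expression. -/
lemma covGrad_addPts {W : TensorField d X n} (hW : IsForm W) {η : Config X} {p : Fin m → X}
    (hp : IsFresh η p) (hd : DifferentiableAt ℝ (localForm hW η p) (chartCenters p))
    (c : Fin (n + 1) → Fin m) (u : Fin (n + 1) → EuclideanSpace ℝ (Fin d)) :
    covGrad W (η.addPts p) (fun i => p (c i)) u =
      fderiv ℝ (localForm hW η p) (chartCenters p) (Pi.single (c 0) (u 0))
          (fun i => Pi.single (c i.succ) (u i.succ)) -
        ∑ i : Fin n, if c i.succ = c 0 then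
          W (η.addPts p) (fun i => p (c i.succ))
            (Function.update (fun i : Fin n => u i.succ) i
              (christoffel (p (c 0)) (u 0) (u i.succ)) : Fin n → EuclideanSpace ℝ (Fin d))
        else 0 := by
  classical
  have hmem : p (c 0) ∈ (η.addPts p).carrier := Or.inr ⟨c 0, rfl⟩
  have hrep : localRep W (η.addPts p) (p (c 0)) (fun i => p (c i.succ)) (fun i => u i.succ) =
      fun z => localForm hW η p (Function.update (chartCenters p) (c 0) z)
        (fun i => Pi.single (c i.succ) (u i.succ)) := by
    funext z
    have hq : chartPts p (Function.update (chartCenters p) (c 0) z) =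
        Function.update p (c 0) (chartPt (p (c 0)) z) := by
      funext j
      rcases eq_or_ne j (c 0) with rfl | hj
      · simp [chartPts]
      · simp [chartPts, chartCenters, hj, chartPt_chartCenter]
    rw [localForm_single, localComp, hq]
    unfold localRep
    refine tensorField_congr W (move_addPts hp (c 0) _) (funext fun i => ?_) (funext fun i => ?_)
    · rcases eq_or_ne (c i.succ) (c 0) with hi | hi
      · simp [hi]
      · simp [hi, hp.1.eq_iff]
    · rcases eq_or_ne (c i.succ) (c 0) with hi | hi
      · refine (if_pos (congrArg p hi)).trans (frame_congr (congrArg p hi.symm) ?_ _)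
        rw [hi, Function.update_self]
      · refine (if_neg fun h => hi (hp.1 h)).trans ?_
        exact (frame_self (p (c i.succ)) (u i.succ)).symm.trans
          (frame_congr rfl (show p (c i.succ) = Function.update p (c 0) _ (c i.succ) from
            (Function.update_of_ne hi _ _).symm) _)
  have hder : HasFDerivAt (localRep W (η.addPts p) (p (c 0)) (fun i => p (c i.succ))
      (fun i => u i.succ))
      (((ContinuousAlternatingMap.apply ℝ (Fin m → EuclideanSpace ℝ (Fin d)) ℝ
        (fun i : Fin n => Pi.single (c i.succ) (u i.succ))).comp
          (fderiv ℝ (localForm hW η p) (chartCenters p))).comp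
        (ContinuousLinearMap.pi (Pi.single (c 0) (ContinuousLinearMap.id ℝ _))))
      (chartCenter (p (c 0))) := by
    rw [hrep]
    have h1 := hasFDerivAt_update (𝕜 := ℝ) (chartCenters (d := d) p) (i := c 0)
      (chartCenter (p (c 0)))
    have h0 : Function.update (chartCenters (d := d) p) (c 0) (chartCenter (p (c 0))) =
      chartCenters p := Function.update_eq_self (c 0) (chartCenters (d := d) p)
    have h2 : HasFDerivAt (localForm hW η p) (fderiv ℝ (localForm hW η p) (chartCenters p))
      (Function.update (chartCenters (d := d) p) (c 0) (chartCenter (p (c 0)))) := by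
      rw [h0]; exact hd.hasFDerivAt
    exact ((ContinuousAlternatingMap.apply ℝ (Fin m → EuclideanSpace ℝ (Fin d)) ℝ
        (fun i : Fin n => Pi.single (c i.succ) (u i.succ))).hasFDerivAt.comp _ h2).comp _ h1
  unfold covGrad
  rw [if_pos hmem, hder.fderiv]
  congr 1
  · have : (ContinuousLinearMap.pi (Pi.single (c 0) (ContinuousLinearMap.id ℝ _)) :
        EuclideanSpace ℝ (Fin d) →L[ℝ] Fin m → EuclideanSpace ℝ (Fin d)) (u 0) =
        Pi.single (c 0) (u 0) := by
      funext j
      rcases eq_or_ne j (c 0) with rfl | hj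
      · simp
      · simp [hj]
    rw [← this]
    rfl
  · refine Finset.sum_congr rfl fun i _ => ?_
    simp only [hp.1.eq_iff]
    congr

/-- Evaluated at the centres of the charts, the differential of a form over the configuration space
is the exterior derivative of its coordinate expression: the Christoffel terms are symmetric in two
slots and disappear in the antisymmetrization. -/
lemma extD_addPts {W : TensorField d X n} (hW : IsForm W) {η : Config X} {p : Fin m → X}
    (hp : IsFresh η p) (hd : DifferentiableAt ℝ (localForm hW η p) (chartCenters p))
    (b : Fin (n + 1) → Fin m) (v : Fin (n + 1) → EuclideanSpace ℝ (Fin d)) :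
    extD W (η.addPts p) (fun i => p (b i)) v =
      Real.sqrt (n + 1) / (n + 1) *
        extDeriv (localForm hW η p) (chartCenters p) (fun i => Pi.single (b i) (v i)) := by
  classical
  have hchr : ∀ i : Fin n, ∑ σ : Equiv.Perm (Fin (n + 1)), ((Equiv.Perm.sign σ : ℤ) : ℝ) *
      (if b (σ i.succ) = b (σ 0) then
          W (η.addPts p) (fun k => p (b (σ k.succ)))
            (Function.update (fun k : Fin n => v (σ k.succ)) i
              (christoffel (p (b (σ 0))) (v (σ 0)) (v (σ i.succ))) :
                Fin n → EuclideanSpace ℝ (Fin d))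
        else 0) = 0 := by
    intro i
    refine sum_sign_mul_eq_zero (Fin.succ_ne_zero i).symm _ fun σ => ?_
    have hk : ∀ k : Fin n, k ≠ i → (σ * Equiv.swap 0 i.succ) k.succ = σ k.succ := fun k hk => by
      rw [Equiv.Perm.mul_apply, Equiv.swap_apply_of_ne_of_ne (Fin.succ_ne_zero k)
        fun h => hk (Fin.succ_injective _ h)]
    have h0 : (σ * Equiv.swap 0 i.succ) 0 = σ i.succ := by simp
    have hi : (σ * Equiv.swap 0 i.succ) i.succ = σ 0 := by simp
    rw [h0, hi]
    by_cases hc : b (σ i.succ) = b (σ 0)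
    · rw [if_pos hc, if_pos hc.symm]
      refine tensorField_congr W rfl (funext fun k => ?_) (funext fun k => ?_)
      · rcases eq_or_ne k i with rfl | hki
        · rw [hi, hc]
        · rw [hk k hki]
      · rcases eq_or_ne k i with rfl | hki
        · refine (Function.update_self (β := fun _ => EuclideanSpace ℝ (Fin d)) k _ _).trans
            (Eq.trans ?_ (Function.update_self (β := fun _ => EuclideanSpace ℝ (Fin d)) k _ _).symm)
          exact christoffel_swap (congrArg p hc) _ _
        · refine (Function.update_of_ne (β := fun _ => EuclideanSpace ℝ (Fin d)) hki _ _).trans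
            (Eq.trans ?_
              (Function.update_of_ne (β := fun _ => EuclideanSpace ℝ (Fin d)) hki _ _).symm)
          exact congrArg v (hk k hki)
    · rw [if_neg hc, if_neg fun h => hc h.symm]
  have hsum : ∑ σ : Equiv.Perm (Fin (n + 1)), ((Equiv.Perm.sign σ : ℤ) : ℝ) *
      covGrad W (η.addPts p) (fun i => p (b (σ i))) (fun i => v (σ i)) =
      n.factorial *
        extDeriv (localForm hW η p) (chartCenters p) (fun i => Pi.single (b i) (v i)) := by
    rw [extDeriv, ← sum_sign_mul_eq_alternatizeUncurryFin]
    have hcov := fun σ : Equiv.Perm (Fin (n + 1)) =>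
      covGrad_addPts hW hp hd (fun i => b (σ i)) (fun i => v (σ i))
    simp only [hcov, mul_sub, Finset.sum_sub_distrib, Finset.mul_sum]
    rw [Finset.sum_comm (s := Finset.univ) (t := Finset.univ (α := Fin n)),
      Finset.sum_eq_zero (s := Finset.univ (α := Fin n)) fun i _ => hchr i, sub_zero]
  change Real.sqrt (n + 1) * (((n + 1).factorial : ℝ)⁻¹ *
    ∑ σ : Equiv.Perm (Fin (n + 1)), ((Equiv.Perm.sign σ : ℤ) : ℝ) *
      covGrad W (η.addPts p) (fun i => p (b (σ i))) (fun i => v (σ i))) = _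
  rw [hsum, Nat.factorial_succ]
  have h1 : (n.factorial : ℝ) ≠ 0 := by positivity
  have h2 : (n + 1 : ℝ) ≠ 0 := by positivity
  push_cast
  field_simp

lemma sum_extD_addPts {W : TensorField d X n} (hW : IsForm W) {η : Config X} {p : Fin m → X}
    (hp : IsFresh η p) (hd : DifferentiableAt ℝ (localForm hW η p) (chartCenters p))
    (ξ : Fin (n + 1) → Fin m → EuclideanSpace ℝ (Fin d)) :
    ∑ b : Fin (n + 1) → Fin m, extD W (η.addPts p) (fun i => p (b i))
        (fun i => ξ i (b i) : Fin (n + 1) → EuclideanSpace ℝ (Fin d)) =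
      Real.sqrt (n + 1) / (n + 1) * extDeriv (localForm hW η p) (chartCenters p) ξ := by
  have h : ξ = fun i => ∑ j, Pi.single j (ξ i j) :=
    funext fun i => (Finset.univ_sum_single (ξ i)).symm
  conv_rhs => rw [h]
  rw [ContinuousAlternatingMap.map_sum, Finset.mul_sum]
  exact Finset.sum_congr rfl fun b _ => extD_addPts hW hp hd b _

lemma minSmoothness_two_le_infty : minSmoothness ℝ 2 ≤ (∞ : WithTop ℕ∞) := by
  rw [minSmoothness_of_isRCLikeNormedField]
  exact WithTop.coe_le_coe.2 (le_top : (2 : ℕ∞) ≤ ⊤)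

/-- The transition map between the charts at the points `p_j` and the charts at the points `q_j`. -/
def chartTransition (p q : Fin m → X) (z : Fin m → EuclideanSpace ℝ (Fin d)) :
    Fin m → EuclideanSpace ℝ (Fin d) :=
  fun j => chartAt (EuclideanSpace ℝ (Fin d)) (q j) (chartPt (p j) (z j))

omit [RiemannianBundle (fun x : X => TangentSpace (𝓡 d) x)] in
lemma fderiv_chartTransition {p q : Fin m → X} {z : Fin m → EuclideanSpace ℝ (Fin d)}
    (hz : ∀ j, z j ∈ (chartAt (EuclideanSpace ℝ (Fin d)) (p j)).target)
    (hq : ∀ j, chartPt (p j) (z j) ∈ (chartAt (EuclideanSpace ℝ (Fin d)) (q j)).source)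
    (ξ : Fin m → EuclideanSpace ℝ (Fin d)) (j : Fin m) :
    fderiv ℝ (chartTransition p q) z ξ j =
      tangentCoordChange (𝓡 d) (p j) (q j) (chartPt (p j) (z j)) (ξ j) := by
  have h : HasFDerivAt (chartTransition p q) (ContinuousLinearMap.pi fun j =>
      (tangentCoordChange (𝓡 d) (p j) (q j) (chartPt (p j) (z j))).comp
        (ContinuousLinearMap.proj j)) z :=
    hasFDerivAt_pi.2 fun j =>
      HasFDerivAt.comp (f := fun z : Fin m → EuclideanSpace ℝ (Fin d) => z j)
        (g := fun z => chartAt (EuclideanSpace ℝ (Fin d)) (q j) (chartPt (p j) z)) z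
        (hasFDerivAt_chart_transition (hz j) (hq j)) (hasFDerivAt_apply j z)
  rw [h.fderiv]
  rfl

/-- Coordinate expressions of a form in different charts are pullbacks of one another. -/
lemma localForm_eq_pullback {W : TensorField d X n} (hW : IsForm W) (η : Config X)
    {p q : Fin m → X} {z : Fin m → EuclideanSpace ℝ (Fin d)}
    (hz : ∀ j, z j ∈ (chartAt (EuclideanSpace ℝ (Fin d)) (p j)).target)
    (hq : ∀ j, chartPt (p j) (z j) ∈ (chartAt (EuclideanSpace ℝ (Fin d)) (q j)).source) :
    localForm hW η p z = (localForm hW η q (chartTransition p q z)).compContinuousLinearMap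
      (fderiv ℝ (chartTransition p q) z) := by
  ext ξ
  have hpts : chartPts q (chartTransition p q z) = chartPts p z :=
    funext fun j => (chartAt _ (q j)).left_inv (hq j)
  rw [ContinuousAlternatingMap.compContinuousLinearMap_apply, localForm_apply, localForm_apply]
  refine Finset.sum_congr rfl fun b _ => ?_
  unfold localComp
  rw [hpts]
  refine tensorField_congr W rfl rfl (funext fun i => ?_)
  simp only [Function.comp_apply, fderiv_chartTransition hz hq]
  exact (frame_tangentCoordChange (chartPt_mem_source (hz (b i))) (hq (b i)) _).symm

/-- Near the centres of the charts, the coordinate expression of the differential is the exterior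
derivative of the coordinate expression. -/
lemma localForm_extD [T2Space X] {W : TensorField d X n} (hW : IsForm W) (hs : IsJointlySmooth W)
    (hV : IsForm (extD W)) {η : Config X} {p : Fin m → X} (hp : IsFresh η p) :
    localForm hV η p =ᶠ[𝓝 (chartCenters p)]
      (Real.sqrt (n + 1) / (n + 1)) • extDeriv (localForm hW η p) := by
  filter_upwards [eventually_chartPts (d := d) hp] with z hz
  obtain ⟨hq, hz⟩ := hz
  -- The charts at the moved points `q`: there the differential is computed at the centres.
  set q := chartPts p z with hqdef
  have hsrc : ∀ j, chartPt (p j) (z j) ∈ (chartAt (EuclideanSpace ℝ (Fin d)) (q j)).source :=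
    fun j => mem_chart_source _ _
  have hcenter : chartTransition p q z = chartCenters q := rfl
  have hdiff : DifferentiableAt ℝ (localForm hW η q) (chartCenters q) :=
    (contDiffAt_localForm hW hs hq).differentiableAt (by simp)
  have hT : ContDiffAt ℝ ∞ (chartTransition p q) z :=
    contDiffAt_pi.2 fun j =>
      ContDiffAt.comp (f := fun z : Fin m → EuclideanSpace ℝ (Fin d) => z j)
        (g := fun z => chartAt (EuclideanSpace ℝ (Fin d)) (q j) (chartPt (p j) z)) z
        (contDiffAt_chart_transition (hz j) (hsrc j)) (contDiff_apply ℝ _ j).contDiffAt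
  have hnear : localForm hW η p =ᶠ[𝓝 z] fun z' =>
      (localForm hW η q (chartTransition p q z')).compContinuousLinearMap
        (fderiv ℝ (chartTransition p q) z') := by
    have h1 : ∀ᶠ z' in 𝓝 z, ∀ j, z' j ∈ (chartAt (EuclideanSpace ℝ (Fin d)) (p j)).target :=
      Filter.eventually_all.2 fun j => (continuous_apply j).continuousAt.eventually
        ((chartAt _ (p j)).open_target.mem_nhds (hz j))
    have h2 : ∀ᶠ z' in 𝓝 z, ∀ j,
        chartPt (p j) (z' j) ∈ (chartAt (EuclideanSpace ℝ (Fin d)) (q j)).source :=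
      Filter.eventually_all.2 fun j =>
        ((continuousAt_chartPt (hz j)).comp (f := fun z' : Fin m → EuclideanSpace ℝ (Fin d) => z' j)
          (continuous_apply j).continuousAt).eventually
          ((chartAt _ (q j)).open_source.mem_nhds (hsrc j))
    filter_upwards [h1, h2] with z' hz' hq' using localForm_eq_pullback hW η hz' hq'
  have hpull : extDeriv (localForm hW η p) z =
      (extDeriv (localForm hW η q) (chartCenters q)).compContinuousLinearMap
        (fderiv ℝ (chartTransition p q) z) := by
    rw [hnear.extDeriv_eq]
    exact extDeriv_pullback (by rw [hcenter]; exact hdiff) hT minSmoothness_two_le_infty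
  ext ξ
  rw [Pi.smul_apply, hpull, ContinuousAlternatingMap.smul_apply, smul_eq_mul,
    ContinuousAlternatingMap.compContinuousLinearMap_apply, ← sum_extD_addPts hW hq hdiff,
    localForm_apply]
  refine Finset.sum_congr rfl fun b _ => tensorField_congr _ rfl rfl (funext fun i => ?_)
  simp only [Function.comp_apply, fderiv_chartTransition hz hsrc]
  exact frame_eq_tangentCoordChange (chartPt_mem_source (hz (b i))) _

/-- The differential of a form vanishes on indices outside of the configuration. -/
lemma extD_apply_of_notMem [T2Space X] {W : TensorField d X n} (hW : IsForm W) {γ : Config X}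
    {x : Fin (n + 1) → X} (hx : ∃ i, x i ∉ γ.carrier)
    (v : (i : Fin (n + 1)) → TangentSpace (𝓡 d) (x i)) : extD W γ x v = 0 := by
  classical
  have hcov : ∀ (y : Fin (n + 1) → X) (w : (i : Fin (n + 1)) → TangentSpace (𝓡 d) (y i)),
      (∃ i, y i ∉ γ.carrier) → covGrad W γ y w = 0 := by
    intro y w hy
    by_cases h0 : y 0 ∈ γ.carrier
    · obtain ⟨i, hi⟩ : ∃ i : Fin n, y i.succ ∉ γ.carrier := by
        obtain ⟨i, hi⟩ := hy
        rcases Fin.eq_zero_or_eq_succ i with rfl | ⟨j, rfl⟩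
        · exact (hi h0).elim
        · exact ⟨j, hi⟩
      have hne : y i.succ ≠ y 0 := fun h => hi (h ▸ h0)
      -- The moving point starts at `y 0`, so it stays away from `y i.succ` for a while.
      have hrep : localRep W γ (y 0) (fun i => y i.succ) (fun i => w i.succ)
          =ᶠ[𝓝 (chartCenter (y 0))] fun _ => (0 : ℝ) := by
        have h := (tendsto_chartPt (d := d) (y 0)).eventually
          (isOpen_compl_singleton.mem_nhds (show y 0 ∈ ({y i.succ} : Set X)ᶜ from hne.symm))
        filter_upwards [h] with z hz
        refine hW.supp _ _ _ ⟨i, ?_⟩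
        rw [if_neg hne]
        rintro (h | ⟨_, h⟩)
        · exact hi h.1
        · exact hz h
      unfold covGrad
      rw [if_pos h0, hrep.fderiv_eq]
      simp only [hW.supp _ (fun i => y i.succ) _ ⟨i, hi⟩, ite_self, Finset.sum_const_zero, sub_zero,
        fderiv_const_apply]
      rfl
    · exact if_neg h0
  change Real.sqrt (n + 1) * (((n + 1).factorial : ℝ)⁻¹ *
    ∑ σ : Equiv.Perm (Fin (n + 1)), ((Equiv.Perm.sign σ : ℤ) : ℝ) *
      covGrad W γ (fun i => x (σ i)) (fun i => v (σ i))) = 0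
  rw [Finset.sum_eq_zero, mul_zero, mul_zero]
  intro σ _
  obtain ⟨i, hi⟩ := hx
  rw [hcov (fun i => x (σ i)) _ ⟨σ.symm i, by simpa using hi⟩, mul_zero]

/-- The differentials over the configuration space form a complex. -/
theorem extD_extD [T2Space X] {W : TensorField d X n} (hW : IsForm W) (hs : IsJointlySmooth W)
    (hV : IsForm (extD W)) (hVs : IsJointlySmooth (extD W)) : extD (extD W) = 0 := by
  funext γ x v
  by_cases hx : ∃ i, x i ∉ γ.carrier
  · exact extD_apply_of_notMem hV hx v
  push Not at hx
  obtain ⟨m, η, p, b, hp, rfl, rfl⟩ := exists_eq_addPts hx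
  have hd : extDeriv (localForm hV η p) (chartCenters p) = 0 := by
    rw [(localForm_extD hW hs hV hp).extDeriv_eq, extDeriv_smul,
      extDeriv_extDeriv_apply (contDiffAt_localForm hW hs hp) minSmoothness_two_le_infty, smul_zero]
  refine (extD_addPts hV hp
    ((contDiffAt_localForm hV hVs hp).differentiableAt (by simp)) b v).trans ?_
  rw [hd]
  simp

end Differential

/-! ### The forms of the complex -/

section Forms

variable {d : ℕ} {X : Type*} [TopologicalSpace X] [ChartedSpace (EuclideanSpace ℝ (Fin d)) X]
  [IsManifold (𝓡 d) ∞ X] [RiemannianBundle (fun x : X => TangentSpace (𝓡 d) x)] {n m : ℕ}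

lemma isForm_of_mem_EForms {W : TensorField d X n} (hW : W ∈ EForms d X n) : IsForm W := by
  cases n with
  | zero =>
    obtain ⟨F, -, rfl⟩ := hW
    exact
      { supp := fun _ _ _ ⟨i, _⟩ => i.elim0
        multilinear := fun γ x => ⟨MultilinearMap.constOfIsEmpty ℝ _ (F γ), fun v => rfl⟩
        alternating := fun γ x v σ => by simp [Subsingleton.elim σ 1]
        summable := fun γ => Summable.of_finite }
  | succ n => exact hW.1.1.toIsForm

lemma isJointlySmooth_of_mem_EForms [T2Space X] {W : TensorField d X n} (hW : W ∈ EForms d X n) :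
    IsJointlySmooth W := by
  intro η m p hp b u
  have hev := eventually_chartPts (d := d) hp
  cases n with
  | zero =>
    obtain ⟨F, ⟨N, g, φ, hg, -, hφ, hF⟩, rfl⟩ := hW
    have hsm : ContDiffAt ℝ ∞ (fun z : Fin m → EuclideanSpace ℝ (Fin d) =>
        g fun i => Config.pairing (φ i) η + ∑ j, φ i (chartPt (p j) (z j))) (chartCenters p) := by
      refine hg.contDiffAt.comp _ (contDiffAt_pi.2 fun i => contDiffAt_const.add
        (ContDiffAt.sum fun j _ => ?_))
      have h1 : ContDiffAt ℝ ∞ (fun z => φ i (chartPt (p j) z))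
          (chartCenter (d := d) (p j)) := by
        have h := ((hφ i).1.contMDiffAt (x := p j))
        rw [contMDiffAt_iff] at h
        simpa [Function.comp_def, contDiffWithinAt_univ] using! h.2
      exact ContDiffAt.comp (f := fun z : Fin m → EuclideanSpace ℝ (Fin d) => z j)
        (g := fun z => φ i (chartPt (p j) z)) _ h1 (contDiff_apply ℝ _ j).contDiffAt
    refine hsm.congr_of_eventuallyEq ?_
    filter_upwards [hev] with z hz
    change F (η.addPts (chartPts p z)) = _
    rw [hF]
    exact congrArg g (funext fun i => pairing_addPts (hφ i).2 hz.1)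
  | succ n =>
    obtain ⟨θ, -, hext, hsm⟩ := hW.2.1 η m
    refine (hsm (fun i => Sum.inr (b i)) p u).congr_of_eventuallyEq ?_
    filter_upwards [hev] with z hz
    exact (hext (chartPts p z) hz.1.1 hz.1.2 (fun i => Sum.inr (b i)) _).symm

lemma covGrad_zero : covGrad (0 : TensorField d X n) = 0 := by
  funext γ x v
  have h : fderiv ℝ (localRep (0 : TensorField d X n) γ (x 0) (fun i => x i.succ)
      (fun i => v i.succ)) (chartCenter (x 0)) = 0 := fderiv_const_apply (0 : ℝ)
  unfold covGrad
  split_ifs with h0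
  · rw [h]
    simp only [Pi.zero_apply, ite_self, Finset.sum_const_zero, sub_zero]
    rfl
  · rfl

lemma iterGrad_zero (k : ℕ) : iterGrad (0 : TensorField d X n) k = 0 := by
  induction k with
  | zero => rfl
  | succ k ih => rw [iterGrad, ih]; exact covGrad_zero

omit [IsManifold (𝓡 d) ∞ X] in
lemma tInner_zero_left (γ : Config X) (v : Coeff d X n) :
    tInner ((0 : TensorField d X n) γ) v = 0 := by
  simp [tInner, compInner]

lemma pairing_zero_pow (γ : Config X) : Config.pairing (fun _ : X => (0 : ℝ)) γ ^ 1 = 0 := by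
  simp [Config.pairing]

lemma zero_mem_EForms_succ : (0 : TensorField d X (n + 1)) ∈ EForms d X (n + 1) := by
  have hbound : ∀ k (γ : Config X), tInner (iterGrad (0 : TensorField d X (n + 1)) k γ)
      (iterGrad (0 : TensorField d X (n + 1)) k γ) ≤ Config.pairing (fun _ : X => (0 : ℝ)) γ ^ 1 :=
    fun k γ => by
      rw [iterGrad_zero, pairing_zero_pow]
      exact (tInner_zero_left γ _).le
  have hform : IsLocalForm (0 : TensorField d X (n + 1)) :=
    { supp := fun _ _ _ _ => rfl
      multilinear := fun γ x => ⟨0, fun v => rfl⟩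
      alternating := fun γ x v σ => (mul_zero _).symm
      summable := fun γ => by
        have : compInner ((0 : TensorField d X (n + 1)) γ) ((0 : TensorField d X (n + 1)) γ) = 0 := by
          funext x; simp [compInner]
        rw [this]; exact summable_zero
      isLocal := ⟨∅, isOpen_empty, by simp, fun γ => rfl⟩
      diff := fun k => by
        rw [iterGrad_zero]
        exact fun γ p _ x w => differentiableAt_const (0 : ℝ)
      bound := ⟨fun _ => 0, 1, continuous_const, HasCompactSupport.zero, fun _ => le_rfl, le_rfl,
        hbound 0⟩ }
  refine ⟨⟨hform, fun V _ => ?_⟩, fun γ r => ⟨fun _ _ => 0, ?_, ?_, ?_⟩, fun k =>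
    ⟨fun _ => 0, 1, ⟨contMDiff_const, HasCompactSupport.zero⟩, fun _ => le_rfl, le_rfl, hbound k⟩⟩
  · simp only [tInner_zero_left]
    exact measurable_const
  · intro a x v σ
    simp
  · intro x _ _ a v
    rfl
  · intro a p w
    exact contDiffAt_const

end Forms

/-! ### Hilbert complexes of closed linear relations -/

section HilbertComplex

variable {H₀ H₁ H₂ : Type*}
  [NormedAddCommGroup H₀] [InnerProductSpace ℝ H₀]
  [NormedAddCommGroup H₁] [InnerProductSpace ℝ H₁]
  [NormedAddCommGroup H₂] [InnerProductSpace ℝ H₂]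

lemma mem_graphKer {T : Submodule ℝ (H₁ × H₂)} {h : H₁} : h ∈ graphKer T ↔ (h, (0 : H₂)) ∈ T :=
  Iff.rfl

lemma mem_graphRange {T : Submodule ℝ (H₁ × H₂)} {k : H₂} : k ∈ graphRange T ↔ ∃ h, (h, k) ∈ T := by
  simp [graphRange]

lemma isClosed_graphKer {T : Submodule ℝ (H₁ × H₂)} (hT : IsClosed (T : Set (H₁ × H₂))) :
    IsClosed (graphKer T : Set H₁) :=
  hT.preimage (f := fun h : H₁ => (h, (0 : H₂))) (by fun_prop)

/-- The pairing `⟨b, y⟩ - ⟨a, x⟩`, which vanishes on a graph and its adjoint, vanishes also on the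
closure of the graph. -/
lemma inner_eq_of_mem_closure_of_mem_adjoint {T : Submodule ℝ (H₁ × H₂)} {h : H₁} {k y : H₂}
    {x : H₁} (hT : (h, k) ∈ T.topologicalClosure) (hx : (y, x) ∈ T.adjoint) :
    inner ℝ k y = inner ℝ h x := by
  have hc : IsClosed {q : H₁ × H₂ | inner ℝ q.2 y = inner ℝ q.1 x} :=
    isClosed_eq (by fun_prop) (by fun_prop)
  have hsub : (T : Set (H₁ × H₂)) ⊆ {q | inner ℝ q.2 y = inner ℝ q.1 x} := by
    rintro ⟨a, b⟩ hab
    exact sub_eq_zero.1 ((Submodule.mem_adjoint_iff T (y, x)).1 hx a b hab)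
  exact closure_minimal hsub hc hT

/-- An element orthogonal to the range of the adjoint lies in the kernel of the closure: the
double adjoint of a linear relation is its closure. -/
lemma mem_graphKer_closure_of_orthogonal [CompleteSpace H₁] [CompleteSpace H₂]
    {T : Submodule ℝ (H₁ × H₂)} {h : H₁}
    (hh : h ∈ (graphRange T.adjoint)ᗮ) : h ∈ graphKer T.topologicalClosure := by
  set e := WithLp.prodContinuousLinearEquiv 2 ℝ H₁ H₂ with he
  set S : Submodule ℝ (WithLp 2 (H₁ × H₂)) := T.comap (e : WithLp 2 (H₁ × H₂) →ₗ[ℝ] H₁ × H₂) with hS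
  have key : e.symm (h, 0) ∈ S.topologicalClosure := by
    rw [← Submodule.orthogonal_orthogonal_eq_closure, Submodule.mem_orthogonal]
    intro u hu
    rw [Submodule.mem_orthogonal] at hu
    have h2 : (u.snd, -u.fst) ∈ T.adjoint := by
      rw [Submodule.mem_adjoint_iff]
      intro a b hab
      have := hu (e.symm (a, b)) (by simpa [hS] using hab)
      rw [WithLp.prod_inner_apply] at this
      simp only [he, inner_neg_right] at this ⊢
      simp at this
      linarith
    have h3 := (Submodule.mem_orthogonal _ _).1 hh _ (mem_graphRange.2 ⟨_, h2⟩)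
    rw [WithLp.prod_inner_apply]
    simp only [inner_neg_left] at h3
    simp [he]
    linarith
  have hcl : closure (S : Set (WithLp 2 (H₁ × H₂))) ⊆ e ⁻¹' closure (T : Set (H₁ × H₂)) :=
    closure_minimal (fun x hx => subset_closure hx) (isClosed_closure.preimage e.continuous)
  exact hcl key

lemma graphRange_adjoint_orthogonal [CompleteSpace H₁] [CompleteSpace H₂]
    (T : Submodule ℝ (H₁ × H₂)) : (graphRange T.adjoint)ᗮ = graphKer T.topologicalClosure := by
  refine le_antisymm (fun h => mem_graphKer_closure_of_orthogonal) fun h hh => ?_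
  rw [Submodule.mem_orthogonal']
  intro x hx
  obtain ⟨y, hy⟩ := mem_graphRange.1 hx
  rw [← inner_eq_of_mem_closure_of_mem_adjoint (mem_graphKer.1 hh) hy, inner_zero_left]

lemma graphKer_adjoint (T : Submodule ℝ (H₀ × H₁)) :
    graphKer T.adjoint = (graphRange T)ᗮ := by
  ext h
  rw [mem_graphKer, Submodule.mem_adjoint_iff, Submodule.mem_orthogonal]
  simp only [inner_zero_right, sub_zero, mem_graphRange, forall_exists_index]
  exact forall_comm

/-- The Hilbert space quotient of nested closed subspaces is the orthogonal complement of the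
smaller one in the larger one. -/
lemma exists_quotient_isometryEquiv_orthogonal [CompleteSpace H₁] {B Z N : Submodule ℝ H₁}
    (hB : IsClosed (B : Set H₁)) (hBZ : B ≤ Z) (hN : N = Z ⊓ Bᗮ) :
    ∃ Φ : (Z ⧸ B.submoduleOf Z) ≃ₗᵢ[ℝ] N,
      ∀ z : Z, (z : H₁) - Φ (Submodule.Quotient.mk z) ∈ B := by
  subst hN
  have : CompleteSpace B := hB.completeSpace_coe
  have hmem : ∀ z : Z, (z : H₁) - B.starProjection z ∈ Z ⊓ Bᗮ := fun z =>
    ⟨Z.sub_mem z.2 (hBZ (B.starProjection_apply_mem _)), B.sub_starProjection_mem_orthogonal _⟩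
  let f : Z →ₗ[ℝ] (Z ⊓ Bᗮ : Submodule ℝ H₁) :=
    LinearMap.codRestrict _
      ((LinearMap.id - (B.starProjection : H₁ →ₗ[ℝ] H₁)) ∘ₗ Z.subtype) hmem
  have hf : ∀ z : Z, (f z : H₁) = z - B.starProjection z := fun z => rfl
  have hker : LinearMap.ker f = B.submoduleOf Z := by
    ext z
    rw [LinearMap.mem_ker, Submodule.submoduleOf, Submodule.mem_comap, ← Submodule.coe_eq_zero, hf,
      sub_eq_zero, eq_comm, Submodule.starProjection_eq_self_iff]
    exact Iff.rfl
  have hsurj : Function.Surjective f := by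
    rintro ⟨y, hyZ, hyB⟩
    refine ⟨⟨y, hyZ⟩, Subtype.ext ?_⟩
    rw [hf, (Submodule.starProjection_apply_eq_zero_iff _).2 hyB, sub_zero]
  let e : (Z ⧸ B.submoduleOf Z) ≃ₗ[ℝ] (Z ⊓ Bᗮ : Submodule ℝ H₁) :=
    (Submodule.quotEquivOfEq _ _ hker.symm).trans (f.quotKerEquivOfSurjective hsurj)
  have he : ∀ z : Z, e (Submodule.Quotient.mk z) = f z := fun z => rfl
  have hnorm : ∀ z : Z, ‖f z‖ = ‖(Submodule.Quotient.mk z : Z ⧸ B.submoduleOf Z)‖ := by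
    intro z
    have h1 : ‖(Submodule.Quotient.mk z : Z ⧸ B.submoduleOf Z)‖ =
        Metric.infDist z (B.submoduleOf Z : Set Z) := QuotientAddGroup.norm_mk z
    have h2 : ‖f z‖ = dist z (⟨B.starProjection z, hBZ (B.starProjection_apply_mem _)⟩ : Z) := by
      rw [Subtype.dist_eq, dist_eq_norm]; rfl
    rw [h1]
    refine le_antisymm ?_ ?_
    · refine (Metric.le_infDist ⟨0, Submodule.zero_mem _⟩).2 fun b hb => ?_
      rw [h2, Subtype.dist_eq, Subtype.dist_eq, dist_eq_norm, dist_eq_norm,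
        Submodule.starProjection_minimal]
      exact ciInf_le ⟨0, by rintro _ ⟨y, rfl⟩; positivity⟩ (⟨b, hb⟩ : B)
    · rw [h2]
      exact Metric.infDist_le_dist_of_mem (B.starProjection_apply_mem _)
  refine ⟨⟨e, fun q => ?_⟩, fun z => ?_⟩
  · obtain ⟨z, rfl⟩ := Submodule.Quotient.mk_surjective _ q
    exact hnorm z
  · change (z : H₁) - (f z : H₁) ∈ B
    rw [hf, sub_sub_cancel]
    exact B.starProjection_apply_mem _

/-- The orthogonal splitting of a Hilbert space along nested closed subspaces `B ≤ Z = Rᗮ`. -/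
lemma inf_orthogonal_sup_sup_closure_eq_top [CompleteSpace H₁] {B Z R : Submodule ℝ H₁}
    (hB : IsClosed (B : Set H₁)) (hBZ : B ≤ Z) (hR : Rᗮ = Z) :
    Z ⊓ Bᗮ ⊔ B ⊔ R.topologicalClosure = ⊤ := by
  have : CompleteSpace B := hB.completeSpace_coe
  rw [← Submodule.orthogonal_orthogonal_eq_closure, hR]
  have : CompleteSpace Z := by
    rw [← hR]; infer_instance
  have : Z ⊓ Bᗮ ⊔ B = Z := by
    rw [inf_comm, sup_comm]
    exact Submodule.sup_orthogonal_inf_of_hasOrthogonalProjection hBZ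
  rw [this]
  exact Submodule.sup_orthogonal_of_hasOrthogonalProjection

end HilbertComplex

/-! ### The `L²` complex -/

section L2Complex

variable {d : ℕ} {X : Type*} [TopologicalSpace X] [ChartedSpace (EuclideanSpace ℝ (Fin d)) X]
  [IsManifold (𝓡 d) ∞ X] [RiemannianBundle (fun x : X => TangentSpace (𝓡 d) x)] {n : ℕ}
  (μ : Measure (Config X)) [IsProbabilityMeasure μ] [HasFiniteMoments μ]

lemma toL2_zero : toL2 μ (⟨0, zero_mem_EForms_succ⟩ : EForms d X (n + 1)) = 0 :=
  UniformSpace.Completion.coe_zero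

variable (d n)

lemma isClosed_cocycles : IsClosed (cocycles d μ n : Set (L2Space d μ n)) :=
  isClosed_graphKer (Submodule.isClosed_topologicalClosure _)

lemma isClosed_coboundaries : IsClosed (coboundaries d μ n : Set (L2Space d μ (n + 1))) :=
  Submodule.isClosed_topologicalClosure _

lemma coboundaries_le_cocycles [T2Space X] : coboundaries d μ n ≤ cocycles d μ (n + 1) := by
  refine Submodule.topologicalClosure_minimal _ ?_ (isClosed_cocycles d (n + 1) μ)
  unfold graphRange dGraph
  rw [Submodule.map_span, Submodule.span_le]
  rintro _ ⟨_, ⟨W, V, hV, rfl⟩, rfl⟩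
  have hWf := isForm_of_mem_EForms W.2
  have hVf := isForm_of_mem_EForms V.2
  have hWs := isJointlySmooth_of_mem_EForms W.2
  have hVs := isJointlySmooth_of_mem_EForms V.2
  have hdd : (0 : TensorField d X (n + 2)) = extD V.1 := by
    rw [hV] at hVf hVs ⊢
    exact (extD_extD hWf hWs hVf hVs).symm
  refine subset_closure (Submodule.subset_span ⟨V, ⟨0, zero_mem_EForms_succ⟩, hdd, ?_⟩)
  rw [toL2_zero]
  rfl

lemma graphKer_dStar : graphKer (dStar d μ n) = (coboundaries d μ n)ᗮ := by
  rw [dStar, graphKer_adjoint, coboundaries, Submodule.orthogonal_closure]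

/-- Harmonic forms are those which are both closed and co-closed. -/
lemma harmonic_eq : harmonic d μ n = cocycles d μ (n + 1) ⊓ (coboundaries d μ n)ᗮ := by
  rw [← graphKer_dStar]
  ext h
  constructor
  · rintro ⟨a, b, ha, hb, hab⟩
    -- Testing the form against `h` itself gives `‖a‖² + ‖b‖² = 0`.
    have h0 := hab h a b ha hb
    rw [real_inner_self_eq_norm_sq, real_inner_self_eq_norm_sq] at h0
    have h1 : inner ℝ ((0 : L2Space d μ (n + 1))) h = 0 := inner_zero_left _
    have h2 : ‖a‖ ^ 2 + ‖b‖ ^ 2 = 0 := h0.trans h1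
    have ha0 : a = 0 := by
      rw [← norm_eq_zero, ← sq_eq_zero_iff]; nlinarith [sq_nonneg ‖a‖, sq_nonneg ‖b‖]
    have hb0 : b = 0 := by
      rw [← norm_eq_zero, ← sq_eq_zero_iff]; nlinarith [sq_nonneg ‖a‖, sq_nonneg ‖b‖]
    subst ha0 hb0
    exact ⟨ha, hb⟩
  · rintro ⟨ha, hb⟩
    refine ⟨0, 0, ha, hb, fun W' a' b' _ _ => ?_⟩
    rw [inner_zero_left, inner_zero_left, add_zero]
    exact (inner_zero_left _).symm

end L2Complex

end ConfigForms

end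

theorem proposition3p13 {d : ℕ} {X : Type*} [MetricSpace X]
    [ChartedSpace (EuclideanSpace ℝ (Fin d)) X] [IsManifold (𝓡 d) ∞ X]
    [RiemannianBundle (fun x : X => TangentSpace (𝓡 d) x)]
    [IsContMDiffRiemannianBundle (𝓡 d) ∞ (EuclideanSpace ℝ (Fin d))
      (fun x : X => TangentSpace (𝓡 d) x)]
    [IsRiemannianManifold (𝓡 d) X] [CompleteSpace X] [ConnectedSpace X]
    [MeasurableSpace X] [BorelSpace X]
    (hvol : (μHE[d] : Measure X) Set.univ = ⊤)
    (μ : Measure (ConfigForms.Config X)) [IsProbabilityMeasure μ]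
    [ConfigForms.HasFiniteMoments μ]
    (ρ : ConfigForms.Config X → X → ℝ)
    (hσ : ConfigForms.SigmaCondition d μ ρ)
    (G : ConfigForms.Config X → (x : X) → TangentSpace (𝓡 d) x)
    (hB : ConfigForms.LogDerivCondition d μ ρ G)
    (n : ℕ) :
    -- the Hilbert complex in degree `n + 1`
    ConfigForms.coboundaries d μ n ≤ ConfigForms.cocycles d μ (n + 1) ∧
    IsClosed (ConfigForms.cocycles d μ (n + 1) : Set (ConfigForms.L2Space d μ (n + 1))) ∧
    -- harmonic forms are the orthogonal complement of `B^{n+1}` in `Z^{n+1}`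
    ConfigForms.harmonic d μ n =
      ConfigForms.cocycles d μ (n + 1) ⊓ (ConfigForms.coboundaries d μ n)ᗮ ∧
    -- the natural map is an isomorphism of Hilbert spaces
    (∃ Φ : ConfigForms.L2Cohomology d μ n ≃ₗᵢ[ℝ] ConfigForms.harmonic d μ n,
      ∀ z : ConfigForms.cocycles d μ (n + 1),
        (z : ConfigForms.L2Space d μ (n + 1)) - Φ (Submodule.Quotient.mk z) ∈
          ConfigForms.coboundaries d μ n) ∧
    -- the weak Hodge-deRham decomposition
    (ConfigForms.harmonic d μ n ⟂ ConfigForms.coboundaries d μ n ∧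
      ConfigForms.harmonic d μ n ⟂
        (ConfigForms.graphRange (ConfigForms.dStar d μ (n + 1))).topologicalClosure ∧
      ConfigForms.coboundaries d μ n ⟂
        (ConfigForms.graphRange (ConfigForms.dStar d μ (n + 1))).topologicalClosure ∧
      ConfigForms.harmonic d μ n ⊔ ConfigForms.coboundaries d μ n ⊔
        (ConfigForms.graphRange (ConfigForms.dStar d μ (n + 1))).topologicalClosure = ⊤) := by
  have hBZ := ConfigForms.coboundaries_le_cocycles d n μ
  have hBc := ConfigForms.isClosed_coboundaries d n μ
  have hH := ConfigForms.harmonic_eq d n μ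
  have hR : (ConfigForms.graphRange (ConfigForms.dStar d μ (n + 1)))ᗮ =
      ConfigForms.cocycles d μ (n + 1) :=
    ConfigForms.graphRange_adjoint_orthogonal _
  have hZR : ConfigForms.cocycles d μ (n + 1) ⟂
      (ConfigForms.graphRange (ConfigForms.dStar d μ (n + 1))).topologicalClosure := by
    rw [Submodule.isOrtho_iff_le, Submodule.orthogonal_closure, hR]
  refine ⟨hBZ, ConfigForms.isClosed_cocycles d (n + 1) μ, hH,
    ConfigForms.exists_quotient_isometryEquiv_orthogonal hBc hBZ hH, ?_, ?_, ?_, ?_⟩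
  · rw [hH, Submodule.isOrtho_iff_le]
    exact inf_le_right
  · exact hZR.mono_left (hH.le.trans inf_le_left)
  · exact hZR.mono_left hBZ
  · rw [hH]
    exact ConfigForms.inf_orthogonal_sup_sup_closure_eq_top hBc hBZ hR
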